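/- Let $K\subset\mathbb{R}^n$ be a compact convex set with $0\in\operatorname{int}K$, and let $\gamma\in(0,1]$ be such that $\gamma(-K)\subseteq K$. Let $L\subset\mathbb{R}^n$ be a proper linear subspace (i.e. $L\neq\mathbb{R}^n$) and let $q\in\mathbb{R}$ with $q>\dim L+1$. Denote by $K|L$ the orthogonal projection of $K$ onto $L$, and by $\mathcal{H}^k$ the $k$-dimensional Hausdorff measure, normalized to agree with Lebesgue measure on $k$-dimensional subspaces. Define the section function $$g_{K,L,q}(x)=\int_{K\cap(x+L^\perp)}|z|^{q-n}\,\mathrm{d}\mathcal{H}^{n-\dim L}(z),\qquad x\in L,$$ and let $\nabla g_{K,L,q}(x)\in L$ be its gradient as a function on $L$. For $u\in\mathbb{S}^{n-1}$ let $\rho_K(u)=\max\{\rho>0:\rho u\in K\}$, and for a Borel set $\eta\subseteq\mathbb{S}^{n-1}$ let $$\widetilde{\mathrm{C}}_{K,q}(\eta)=\frac1n\int_{\alpha_K^*(\eta)}\rho_K(u)^q\,\mathrm{d}\mathcal{H}^{n-1}(u),$$ where $\alpha_K^*(\eta)$ is the set of all $u\in\mathbb{S}^{n-1}$ such that the boundary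 point $\rho_K(u)u$ of $K$ has an outer unit normal vector in $\eta$ (the $q$-th dual curvature measure of $K$). Then $g_{K,L,q}$ is differentiable at $\mathcal{H}^{\dim L}$-almost every point of $K|L$, the function $x\mapsto\langle\nabla g_{K,L,q}(x),x\rangle$ is $\mathcal{H}^{\dim L}$-integrable on $K|L$, and $$\frac{1}{n\,\widetilde{\mathrm{C}}_{K,q}(\mathbb{S}^{n-1})}\int_{K|L}\langle\nabla g_{K,L,q}(x),x\rangle\,\mathrm{d}\mathcal{H}^{\dim L}(x)\;\le\;\begin{cases}\dfrac{q-\dim L}{q}\cdot\dfrac{1-\gamma}{1+\gamma}, & q\le n,\\[2ex]\dfrac{(q-n)+\frac{1-\gamma}{1+\gamma}\,(n-\dim L)}{q}, & q>n+1.\end{cases}$$ (No bound is claimed for $n<q\le n+1$.) -/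

import Mathlib

open MeasureTheory Set Module
open scoped Pointwise Gradient

noncomputable section

/-- Euclidean space `ℝⁿ`. -/
abbrev E5 (n : ℕ) : Type := EuclideanSpace ℝ (Fin n)

/-- The unit sphere `𝕊ⁿ⁻¹`. -/
abbrev unitSphere (n : ℕ) : Set (E5 n) := Metric.sphere (0 : E5 n) 1

/-- The `(n-1)`-dimensional surface measure on the unit sphere `𝕊ⁿ⁻¹`, i.e. the measure `σ` with
`dx = rⁿ⁻¹ dr dσ(u)` in polar coordinates `x = r u`. -/
def sphereMeasure (n : ℕ) : Measure (unitSphere n) :=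
  (volume : Measure (E5 n)).toSphere

/-- The radial function `ρ_K(x) = max {ρ > 0 : ρ x ∈ K}`. -/
def radialFunction {n : ℕ} (K : Set (E5 n)) (x : E5 n) : ℝ :=
  sSup {r : ℝ | 0 < r ∧ r • x ∈ K}

/-- The support function `h_K(u) = max {⟪u, x⟫ : x ∈ K}`. -/
def supportFunction {n : ℕ} (K : Set (E5 n)) (u : E5 n) : ℝ :=
  sSup ((fun x => inner ℝ u x) '' K)

/-- The supporting hyperplane `H_K(u) = {x : ⟪u, x⟫ = h_K(u)}`. -/
def supportingHyperplane {n : ℕ} (K : Set (E5 n)) (u : E5 n) : Set (E5 n) :=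
  {x | inner ℝ u x = supportFunction K u}

/-- The reverse radial Gauss image `α*_K(η)`: all unit vectors `u` such that the boundary point
`ρ_K(u) u` of `K` has an outer unit normal vector in `η`. -/
def reverseRadialGaussImage {n : ℕ} (K : Set (E5 n)) (η : Set (unitSphere n)) :
    Set (unitSphere n) :=
  {u | ∃ v ∈ η, radialFunction K (u : E5 n) • (u : E5 n) ∈ supportingHyperplane K (v : E5 n)}

/-- The `q`-th dual curvature measure
`C̃_{K,q}(η) = (1/n) ∫_{α*_K(η)} ρ_K(u)^q dℋⁿ⁻¹(u)`. -/
def dualCurvatureMeasure {n : ℕ} (K : Set (E5 n)) (q : ℝ) (η : Set (unitSphere n)) : ℝ :=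
  (1 / (n : ℝ)) *
    ∫ u in reverseRadialGaussImage K η, radialFunction K (u : E5 n) ^ q ∂(sphereMeasure n)

/-- The orthogonal projection `K|L`, as a subset of `L`. -/
def projectionOnto {n : ℕ} (K : Set (E5 n)) (L : Submodule ℝ (E5 n)) : Set L :=
  (fun z => L.orthogonalProjectionOnto z) '' K

/-- The section function
`g_{K,L,q}(x) = ∫_{K ∩ (x + L^⊥)} |z|^{q-n} dℋ^{n - dim L}(z)`, for `x ∈ L`.
Here `μHE[d]` is the `d`-dimensional Hausdorff measure in the normalization that agrees with
Lebesgue measure on `d`-dimensional subspaces. -/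
def sectionFunction {n : ℕ} (K : Set (E5 n)) (L : Submodule ℝ (E5 n)) (q : ℝ) (x : L) : ℝ :=
  ∫ z in K ∩ ({(x : E5 n)} + (Lᗮ : Set (E5 n))), ‖z‖ ^ (q - (n : ℝ)) ∂μHE[finrank ℝ Lᗮ]

end

/-! Write `g` for the section function, `k = dim L`, `p = q - n`, `l = 1 - t(1 + γ)` and `s = 1 -
t(1 - γ)`. If `P` and `Q` lie in the section `S` of `K` over `x`, then `(1 - t)P - tγQ` lies in `K`,
over the contracted point `l x`. So the section over `l x` contains `(1 - t)S - tγS`, whose volume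
is at least `s ^ (n - k)` times that of `S` by Brunn–Minkowski. The weight `|z| ^ p` is handled in
two ways.

If `p ≤ 0`, the superlevel sets of the weight are cut out by balls, so the volume estimate applies
to each of them and `g (l x) ≥ s ^ (q - k) * g x` (`ofReal_mul_sectionMass_le_of_nonpos`). If `p ≥
1`, the points of `S` and `-S` are coupled by monotone transport and each pair is used twice, with
the roles of `P` and `Q` exchanged. Convexity of `|·| ^ p` controls the sum of the two weights, and
`g (l x) ≥ s ^ (n - k) * l ^ p * g x` (`ofReal_mul_sectionMass_le_of_one_le`). The transport step is
`setLIntegral_le_of_reflection`.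

Differentiating at `t = 0` bounds `⟪∇g(x), x⟫` by a constant times `g x`. Fubini and polar
coordinates give `∫ g = n C̃ / q` (`integrable_sectionFunction`), hence the bounds.
Differentiability comes from local Lipschitz estimates and Rademacher's theorem. Integrability comes
from `g (r x) ≥ r ^ (q - k) * g x` for `0 < r ≤ 1` and Fatou's lemma. -/

/-! ### Monotone transport and the Brunn–Minkowski inequality. -/

open Filter Topology ENNReal ProbabilityTheory in
/-- The quantile function of a probability measure on `ℝ` with a density. -/
theorem exists_quantile (α : ℝ → ℝ≥0∞) (hα : Measurable α) (h1 : ∫⁻ x, α x = 1) :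
    ∃ Q : ℝ → ℝ, (∀ f : ℝ → ℝ≥0∞, Measurable f →
        ∫⁻ τ in Ioo (0 : ℝ) 1, f (Q τ) = ∫⁻ x, f x * α x) ∧
      StrictMonoOn Q (Ioo 0 1) ∧
      ∀ᵐ τ ∂(volume.restrict (Ioo (0 : ℝ) 1)), α (Q τ) ≠ 0 ∧ α (Q τ) ≠ ∞ ∧
        HasDerivAt Q ((α (Q τ)).toReal)⁻¹ τ := by
  set ν : Measure ℝ := volume.withDensity α with hν
  have : IsProbabilityMeasure ν := ⟨by simp [hν, h1]⟩
  have hνac : ν ≪ volume := withDensity_absolutelyContinuous _ _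
  have hνa : NullSingletonClass ν := ⟨fun x => hνac (by simp)⟩
  set F := cdf ν with hF
  have hFm : Monotone F := monotone_cdf ν
  have hFc : Continuous F := by
    rw [continuous_iff_continuousAt]
    intro x
    have h0 : F.measure {x} = 0 := by rw [hF, measure_cdf]; simp
    rw [StieltjesFunction.measure_singleton] at h0
    have hle := hFm.leftLim_le (le_refl x)
    have h2 : Function.leftLim F x = F x := by
      have := ENNReal.ofReal_eq_zero.1 h0
      linarith
    rw [hFm.continuousAt_iff_leftLim_eq_rightLim, h2, StieltjesFunction.rightLim_eq]
  set Q : ℝ → ℝ := fun τ => sInf {x | τ ≤ F x} with hQ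
  have hne : ∀ τ ∈ Ioo (0:ℝ) 1, {x | τ ≤ F x}.Nonempty := by
    intro τ hτ
    obtain ⟨x, hx⟩ := ((tendsto_cdf_atTop ν).eventually (lt_mem_nhds hτ.2)).exists
    exact ⟨x, hx.le⟩
  have hbd : ∀ τ ∈ Ioo (0:ℝ) 1, BddBelow {x | τ ≤ F x} := by
    intro τ hτ
    obtain ⟨x, hx⟩ := ((tendsto_cdf_atBot ν).eventually (gt_mem_nhds hτ.1)).exists
    refine ⟨x, fun y hy => ?_⟩
    by_contra hlt
    exact absurd (hFm (not_le.1 hlt).le) (not_le.2 (hx.trans_le hy))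
  have hgal : ∀ τ ∈ Ioo (0:ℝ) 1, ∀ x, Q τ ≤ x ↔ τ ≤ F x := by
    intro τ hτ x
    constructor
    · intro h
      have hcl : IsClosed {x | τ ≤ F x} := isClosed_le continuous_const hFc
      have := hcl.csInf_mem (hne τ hτ) (hbd τ hτ)
      exact le_trans this (hFm h)
    · intro h
      exact csInf_le (hbd τ hτ) h
  have hFQ : ∀ τ ∈ Ioo (0:ℝ) 1, F (Q τ) = τ := by
    intro τ hτ
    apply le_antisymm
    · apply le_of_tendsto (hFc.tendsto (Q τ) |>.mono_left (nhdsWithin_le_nhds (s := Iio (Q τ))))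
      filter_upwards [self_mem_nhdsWithin] with x hx
      by_contra h
      exact absurd ((hgal τ hτ x).2 (not_le.1 h).le) (not_le.2 hx)
    · exact (hgal τ hτ _).1 le_rfl
  have hmono : StrictMonoOn Q (Ioo 0 1) := by
    intro a ha b hb hab
    by_contra h
    have := hFm (not_lt.1 h)
    rw [hFQ a ha, hFQ b hb] at this
    linarith
  have hQae : AEMeasurable Q (volume.restrict (Ioo (0 : ℝ) 1)) :=
    aemeasurable_restrict_of_monotoneOn measurableSet_Ioo hmono.monotoneOn
  have hmap : (volume.restrict (Ioo (0 : ℝ) 1)).map Q = ν := by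
    have : IsFiniteMeasure ((volume.restrict (Ioo (0 : ℝ) 1)).map Q) := by
      infer_instance
    refine Measure.ext_of_Iic _ _ fun x => ?_
    rw [Measure.map_apply_of_aemeasurable hQae measurableSet_Iic, ← ofReal_cdf,
      Measure.restrict_apply₀' measurableSet_Ioo.nullMeasurableSet]
    have : Q ⁻¹' Iic x ∩ Ioo 0 1 = Iic (F x) ∩ Ioo 0 1 := by
      ext τ
      simp only [mem_inter_iff, mem_preimage, mem_Iic]
      exact and_congr_left fun h => hgal τ h x
    rw [this]
    have h0 := cdf_nonneg ν x
    have h1 := cdf_le_one ν x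
    rw [← hF] at h0 h1
    have e2 : (Iic (F x) ∩ Ioo 0 1 : Set ℝ) =ᵐ[volume] Ioc 0 (F x) := by
      have : Ioo 0 (F x) ⊆ (Iic (F x) ∩ Ioo 0 1 : Set ℝ) := fun y hy =>
        ⟨hy.2.le, hy.1, hy.2.trans_le h1⟩
      have h3 : (Iic (F x) ∩ Ioo 0 1 : Set ℝ) ⊆ Ioc 0 (F x) := fun y hy => ⟨hy.2.1, hy.1⟩
      refine Filter.EventuallyLE.antisymm h3.eventuallyLE ?_
      exact (Ioo_ae_eq_Ioc.symm.le).trans this.eventuallyLE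
    rw [measure_congr e2, Real.volume_Ioc, sub_zero]
  have hlint : ∀ f : ℝ → ℝ≥0∞, Measurable f →
        ∫⁻ τ in Ioo (0 : ℝ) 1, f (Q τ) = ∫⁻ x, f x * α x := by
    intro f hf
    rw [← lintegral_map' hf.aemeasurable hQae, hmap, hν,
      lintegral_withDensity_eq_lintegral_mul _ hα hf]
    simp [mul_comm]
  refine ⟨Q, hlint, hmono, ?_⟩
  have hder : ∀ᵐ x ∂ν, α x ≠ 0 ∧ α x ≠ ∞ ∧ HasDerivAt F (α x).toReal x := by
    have e1 : ∀ᵐ x, HasDerivAt F (α x).toReal x := by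
      have := F.ae_hasDerivAt
      rw [hF, measure_cdf] at this
      filter_upwards [this, Measure.rnDeriv_withDensity volume hα] with x hx hx2
      rw [hx2] at hx
      exact hx
    have e2 : ∀ᵐ x, α x ≠ ∞ := by
      filter_upwards [ae_lt_top hα (by rw [h1]; simp)] with x hx using hx.ne
    have e3 : ∀ᵐ x ∂ν, α x ≠ 0 := by
      rw [hν, ae_withDensity_iff hα]
      exact Filter.Eventually.of_forall fun x hx => hx
    filter_upwards [e3, hνac.ae_le e2, hνac.ae_le e1] with x a b c using ⟨a, b, c⟩
  rw [← hmap] at hder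
  have hder := ae_of_ae_map hQae hder
  filter_upwards [hder, ae_restrict_mem measurableSet_Ioo] with τ ⟨h0, ht, hd⟩ hτ
  refine ⟨h0, ht, ?_⟩
  have hpos : 0 < (α (Q τ)).toReal := ENNReal.toReal_pos h0 ht
  have hmem : ∀ᶠ σ in 𝓝 τ, σ ∈ Ioo (0:ℝ) 1 := isOpen_Ioo.mem_nhds hτ
  refine HasDerivAt.of_local_left_inverse ?_ hd hpos.ne' ?_
  -- A quantile function jumps only where `F` has a flat piece. The positive derivative at `Q τ`
  -- excludes a flat piece ending there, so `Q` is continuous at `τ`.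
  · rw [Metric.continuousAt_iff']
    intro ε hε
    have hne : ∀ y, y ≠ Q τ → F y ≠ F (Q τ) := by
      intro y hy he
      -- `F` is constant between `y` and `Q τ`, contradicting the positive derivative
      have hev : ∀ᶠ z in 𝓝[≠] (Q τ), F z ≠ F (Q τ) := by
        have := hd.eventually_ne (c := F (Q τ)) hpos.ne'
        exact this
      rcases lt_or_gt_of_ne hy with hlt | hlt
      · have : ∀ᶠ z in 𝓝[<] (Q τ), F z ≠ F (Q τ) := hev.filter_mono
          (nhdsWithin_mono _ fun z (hz : z < _) => hz.ne)
        obtain ⟨z, hz, hz2⟩ := (this.and (Ioo_mem_nhdsLT hlt)).exists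
        exact hz (le_antisymm (hFm hz2.2.le) (he ▸ hFm hz2.1.le))
      · have : ∀ᶠ z in 𝓝[>] (Q τ), F z ≠ F (Q τ) := hev.filter_mono
          (nhdsWithin_mono _ fun z (hz : _ < z) => hz.ne')
        obtain ⟨z, hz, hz2⟩ := (this.and (Ioo_mem_nhdsGT hlt)).exists
        exact hz (le_antisymm (he ▸ hFm hz2.2.le) (hFm hz2.1.le))
    have l1 : F (Q τ - ε / 2) < τ := by
      have := lt_of_le_of_ne (hFm (show Q τ - ε / 2 ≤ Q τ by linarith))
        (hne _ (by intro h; linarith))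
      rwa [hFQ τ hτ] at this
    have l2 : τ < F (Q τ + ε / 2) := by
      have := lt_of_le_of_ne (hFm (show Q τ ≤ Q τ + ε / 2 by linarith))
        (hne _ (by intro h; linarith)).symm
      rwa [hFQ τ hτ] at this
    filter_upwards [hmem, lt_mem_nhds l1, gt_mem_nhds l2] with σ hσ h1 h2
    have a1 := (hgal σ hσ _).2 h2.le
    have a2 : Q τ - ε / 2 < Q σ := by
      by_contra h
      exact absurd ((hgal σ hσ _).1 (not_lt.1 h)) (not_le.2 h1)
    rw [Real.dist_eq, abs_lt]
    constructor <;> linarith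
  · filter_upwards [hmem] with σ hσ using hFQ σ hσ

open ENNReal in
/-- The reciprocal of a weighted geometric mean is at most the weighted arithmetic mean of
the reciprocals. -/
theorem ofReal_inv_le_arith_mean_inv {a b : ℝ≥0∞} (ha : a ≠ 0) (ha' : a ≠ ∞) (hb : b ≠ 0)
    (hb' : b ≠ ∞) {l : ℝ} (hl : l ∈ Icc (0 : ℝ) 1) :
    (a ^ (1 - l) * b ^ l)⁻¹ ≤
      ENNReal.ofReal |(1 - l) * (a.toReal)⁻¹ + l * (b.toReal)⁻¹| := by
  have h1 : 0 < a.toReal := ENNReal.toReal_pos ha ha'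
  have h2 : 0 < b.toReal := ENNReal.toReal_pos hb hb'
  have key := Real.geom_mean_le_arith_mean2_weighted (sub_nonneg.2 hl.2) hl.1
    (inv_pos.2 h1).le (inv_pos.2 h2).le (by ring)
  have e : (a ^ (1 - l) * b ^ l)⁻¹ =
      ENNReal.ofReal ((a.toReal)⁻¹ ^ (1 - l) * (b.toReal)⁻¹ ^ l) := by
    rw [Real.inv_rpow h1.le, Real.inv_rpow h2.le, ← mul_inv,
      ENNReal.ofReal_inv_of_pos (by positivity), ENNReal.ofReal_mul (by positivity),
      ← ENNReal.ofReal_rpow_of_pos h1, ← ENNReal.ofReal_rpow_of_pos h2,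
      ENNReal.ofReal_toReal ha', ENNReal.ofReal_toReal hb']
  rw [e]
  exact ENNReal.ofReal_le_ofReal (key.trans (le_abs_self _))

open ENNReal in
/-- Change of variables along a convex combination of two quantile functions. -/
theorem setLIntegral_interpolation_le {α β H : ℝ → ℝ≥0∞} {Q R : ℝ → ℝ}
    (hQ : StrictMonoOn Q (Ioo 0 1)) (hR : StrictMonoOn R (Ioo 0 1))
    (hQd : ∀ᵐ τ ∂(volume.restrict (Ioo (0 : ℝ) 1)), α (Q τ) ≠ 0 ∧ α (Q τ) ≠ ∞ ∧
        HasDerivAt Q ((α (Q τ)).toReal)⁻¹ τ)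
    (hRd : ∀ᵐ τ ∂(volume.restrict (Ioo (0 : ℝ) 1)), β (R τ) ≠ 0 ∧ β (R τ) ≠ ∞ ∧
        HasDerivAt R ((β (R τ)).toReal)⁻¹ τ) {l : ℝ} (hl : l ∈ Icc (0 : ℝ) 1) :
    ∫⁻ τ in Ioo (0 : ℝ) 1, H ((1 - l) • Q τ + l • R τ) / (α (Q τ) ^ (1 - l) * β (R τ) ^ l)
      ≤ ∫⁻ x, H x := by
  obtain ⟨E, hE, hEm, hEp⟩ := (hQd.and hRd).exists_measurable_mem
  set D : Set ℝ := E ∩ Ioo 0 1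
  have hD : MeasurableSet D := hEm.inter measurableSet_Ioo
  have hDae : (Ioo 0 1 : Set ℝ) =ᵐ[volume] D := by
    rw [mem_ae_iff, Measure.restrict_apply hEm.compl] at hE
    refine Filter.EventuallyLE.antisymm ?_ inter_subset_right.eventuallyLE
    rw [ae_le_set]
    refine measure_mono_null ?_ hE
    exact fun x hx => ⟨fun h => hx.2 ⟨h, hx.1⟩, hx.1⟩
  rw [setLIntegral_congr hDae]
  set S : ℝ → ℝ := fun τ => (1 - l) • Q τ + l • R τ with hS
  have hinj : InjOn S D := by
    have : StrictMonoOn S D := by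
      intro a ha b hb hab
      have h1 := hQ ha.2 hb.2 hab
      have h2 := hR ha.2 hb.2 hab
      simp only [hS, smul_eq_mul]
      rcases hl.1.eq_or_lt with h0 | h0
      · subst h0; simpa using h1
      · have := mul_lt_mul_of_pos_left h2 h0
        have := mul_le_mul_of_nonneg_left h1.le (sub_nonneg.2 hl.2)
        linarith
    exact this.injOn
  have hder : ∀ τ ∈ D, HasDerivWithinAt S
      ((1 - l) * ((α (Q τ)).toReal)⁻¹ + l * ((β (R τ)).toReal)⁻¹) D τ := by
    intro τ hτ
    obtain ⟨h1, h2⟩ := hEp τ hτ.1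
    exact ((h1.2.2.const_mul (1 - l)).add (h2.2.2.const_mul l)).hasDerivWithinAt
  calc _ ≤ ∫⁻ τ in D, ENNReal.ofReal
        |(1 - l) * ((α (Q τ)).toReal)⁻¹ + l * ((β (R τ)).toReal)⁻¹| * H (S τ) := by
        refine setLIntegral_mono' hD fun τ hτ => ?_
        obtain ⟨h1, h2⟩ := hEp τ hτ.1
        rw [div_eq_mul_inv, mul_comm]
        gcongr
        exact ofReal_inv_le_arith_mean_inv h1.1 h1.2.1 h2.1 h2.2.1 hl
    _ = ∫⁻ x in S '' D, H x := (lintegral_image_eq_lintegral_abs_deriv_mul hD hder hinj H).symm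
    _ ≤ ∫⁻ x, H x := setLIntegral_le_lintegral _ _

open ENNReal in
/-- A functional form of the monotone transport argument for the Brunn–Minkowski inequality:
if the values of `φ` and `ψ` are controlled by those of `H` and `G` at two interpolated points,
weighted by geometric means of the densities `α` and `β`, then so are the integrals. -/
def TransportInequality {V : Type*} [AddCommGroup V] [Module ℝ V] [MeasurableSpace V]
    (μ : Measure V) : Prop :=
  ∀ (α β H G φ ψ : V → ℝ≥0∞), Measurable α → Measurable β → Measurable H → Measurable G →
    Measurable φ → Measurable ψ → ∀ l ∈ Icc (0 : ℝ) 1, ∀ k ∈ Icc (0 : ℝ) 1,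
    ∫⁻ x, α x ∂μ = 1 → ∫⁻ x, β x ∂μ = 1 →
    (∀ a b, α a ≠ 0 → α a ≠ ∞ → β b ≠ 0 → β b ≠ ∞ →
      φ a + ψ b ≤ H ((1 - l) • a + l • b) / (α a ^ (1 - l) * β b ^ l)
        + G ((1 - k) • a + k • b) / (α a ^ (1 - k) * β b ^ k)) →
    ∫⁻ x, φ x * α x ∂μ + ∫⁻ x, ψ x * β x ∂μ ≤ ∫⁻ x, H x ∂μ + ∫⁻ x, G x ∂μ

/-- Both quantile functions are parametrized by the same `τ ∈ (0, 1)`, which is the monotone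
coupling of the two densities. The hypothesis is integrated along this coupling, and each term on
the right is a change of variables. -/
theorem transportInequality_real : TransportInequality (volume : Measure ℝ) := by
  intro α β H G φ ψ hα hβ hH hG hφ hψ l hl k hk hα1 hβ1 h
  obtain ⟨Q, hQi, hQm, hQd⟩ := exists_quantile α hα hα1
  obtain ⟨R, hRi, hRm, hRd⟩ := exists_quantile β hβ hβ1
  have hQae : AEMeasurable Q (volume.restrict (Ioo (0 : ℝ) 1)) :=
    aemeasurable_restrict_of_monotoneOn measurableSet_Ioo hQm.monotoneOn
  have hRae : AEMeasurable R (volume.restrict (Ioo (0 : ℝ) 1)) :=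
    aemeasurable_restrict_of_monotoneOn measurableSet_Ioo hRm.monotoneOn
  have hmeas : AEMeasurable (fun τ => H ((1 - l) • Q τ + l • R τ) /
      (α (Q τ) ^ (1 - l) * β (R τ) ^ l)) (volume.restrict (Ioo (0 : ℝ) 1)) := by
    refine AEMeasurable.div (hH.comp_aemeasurable ?_) (AEMeasurable.mul ?_ ?_)
    · exact (hQae.const_smul (1 - l)).add (hRae.const_smul l)
    · exact (hα.comp_aemeasurable hQae).pow_const _
    · exact (hβ.comp_aemeasurable hRae).pow_const _
  rw [← hQi φ hφ, ← hRi ψ hψ, ← lintegral_add_left' (f := fun τ => φ (Q τ)) (hφ.comp_aemeasurable hQae)]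
  calc _ ≤ ∫⁻ τ in Ioo (0 : ℝ) 1,
        (H ((1 - l) • Q τ + l • R τ) / (α (Q τ) ^ (1 - l) * β (R τ) ^ l)
        + G ((1 - k) • Q τ + k • R τ) / (α (Q τ) ^ (1 - k) * β (R τ) ^ k)) := by
        refine lintegral_mono_ae ?_
        filter_upwards [hQd, hRd] with τ h1 h2
        exact h _ _ h1.1 h1.2.1 h2.1 h2.2.1
    _ ≤ _ := by
        rw [lintegral_add_left' hmeas]
        exact add_le_add (setLIntegral_interpolation_le hQm hRm hQd hRd hl)
          (setLIntegral_interpolation_le hQm hRm hQd hRd hk)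

open ENNReal in
theorem ENNReal.div_geom_mean_div {h x y A B : ℝ≥0∞} (hA : A ≠ 0) (hA' : A ≠ ∞) (hB : B ≠ 0)
    (hB' : B ≠ ∞) {l : ℝ} (hl : l ∈ Icc (0 : ℝ) 1) :
    h / (A ^ (1 - l) * B ^ l) / ((x / A) ^ (1 - l) * (y / B) ^ l) =
      h / (x ^ (1 - l) * y ^ l) := by
  have h1 : A ^ (1 - l) ≠ 0 := (ENNReal.rpow_pos (pos_iff_ne_zero.2 hA) hA').ne'
  have h2 : B ^ l ≠ 0 := (ENNReal.rpow_pos (pos_iff_ne_zero.2 hB) hB').ne'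
  have h3 : A ^ (1 - l) ≠ ∞ := ENNReal.rpow_ne_top_of_nonneg (sub_nonneg.2 hl.2) hA'
  have h4 : B ^ l ≠ ∞ := ENNReal.rpow_ne_top_of_nonneg hl.1 hB'
  rw [ENNReal.div_rpow_of_nonneg _ _ (sub_nonneg.2 hl.2), ENNReal.div_rpow_of_nonneg _ _ hl.1]
  set C := A ^ (1 - l)
  set D := B ^ l
  set X := x ^ (1 - l)
  set Y := y ^ l
  have e : X / C * (Y / D) = (C * D)⁻¹ * (X * Y) := by
    rw [ENNReal.mul_inv (Or.inl h1) (Or.inl h3)]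
    simp only [div_eq_mul_inv]; ring
  have h5 : C * D ≠ 0 := mul_ne_zero h1 h2
  have h6 : C * D ≠ ∞ := ENNReal.mul_ne_top h3 h4
  rw [e, div_eq_mul_inv, div_eq_mul_inv, ENNReal.mul_inv (Or.inl (ENNReal.inv_ne_zero.2 h6))
    (Or.inl (ENNReal.inv_ne_top.2 h5)), inv_inv, mul_assoc, ← mul_assoc (C * D)⁻¹,
    ENNReal.inv_mul_cancel h5 h6, one_mul, div_eq_mul_inv]

open ENNReal in
/-- The transport inequality for densities that are not normalized. -/
theorem TransportInequality.of_ne_zero {V : Type*} [AddCommGroup V] [Module ℝ V]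
    [MeasurableSpace V] {μ : Measure V} (hμ : TransportInequality μ)
    {α β H G φ ψ : V → ℝ≥0∞} (hα : Measurable α) (hβ : Measurable β) (hH : Measurable H)
    (hG : Measurable G) (hφ : Measurable φ) (hψ : Measurable ψ) {l k : ℝ}
    (hl : l ∈ Icc (0 : ℝ) 1) (hk : k ∈ Icc (0 : ℝ) 1)
    (hA : ∫⁻ x, α x ∂μ ≠ 0) (hA' : ∫⁻ x, α x ∂μ ≠ ∞)
    (hB : ∫⁻ x, β x ∂μ ≠ 0) (hB' : ∫⁻ x, β x ∂μ ≠ ∞)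
    (h : ∀ a b, α a ≠ 0 → α a ≠ ∞ → β b ≠ 0 → β b ≠ ∞ →
      φ a + ψ b ≤ H ((1 - l) • a + l • b) / (α a ^ (1 - l) * β b ^ l)
        + G ((1 - k) • a + k • b) / (α a ^ (1 - k) * β b ^ k)) :
    (∫⁻ x, φ x * α x ∂μ) / ∫⁻ x, α x ∂μ + (∫⁻ x, ψ x * β x ∂μ) / ∫⁻ x, β x ∂μ ≤
      (∫⁻ x, H x ∂μ) / ((∫⁻ x, α x ∂μ) ^ (1 - l) * (∫⁻ x, β x ∂μ) ^ l) +
      (∫⁻ x, G x ∂μ) / ((∫⁻ x, α x ∂μ) ^ (1 - k) * (∫⁻ x, β x ∂μ) ^ k) := by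
  set A := ∫⁻ x, α x ∂μ
  set B := ∫⁻ x, β x ∂μ
  have key := hμ (fun x => α x / A) (fun x => β x / B) (fun x => H x / (A ^ (1 - l) * B ^ l))
    (fun x => G x / (A ^ (1 - k) * B ^ k)) φ ψ (hα.div_const _) (hβ.div_const _)
    (hH.div_const _) (hG.div_const _) hφ hψ l hl k hk
    (by simp only [div_eq_mul_inv]; rw [lintegral_mul_const _ hα, ENNReal.mul_inv_cancel hA hA'])
    (by simp only [div_eq_mul_inv]; rw [lintegral_mul_const _ hβ, ENNReal.mul_inv_cancel hB hB'])
    (by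
      intro a b h1 h2 h3 h4
      rw [ENNReal.div_geom_mean_div hA hA' hB hB' hl, ENNReal.div_geom_mean_div hA hA' hB hB' hk]
      refine h a b ?_ ?_ ?_ ?_
      · intro h0; simp [h0] at h1
      · intro h0; exact h2 (by rw [h0, ENNReal.top_div_of_ne_top hA'])
      · intro h0; simp [h0] at h3
      · intro h0; exact h4 (by rw [h0, ENNReal.top_div_of_ne_top hB']))
  simp only [div_eq_mul_inv, ← mul_assoc] at key ⊢
  rwa [lintegral_mul_const _ (by fun_prop), lintegral_mul_const _ (by fun_prop),
    lintegral_mul_const _ hH, lintegral_mul_const _ hG] at key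

open ENNReal in
-- This is Knothe's construction: transport the marginals on `V`, then the normalized fibres on `W`.
-- The inequality on the fibres is exactly the hypothesis needed for the marginals, with `φ` and `ψ`
-- replaced by their fibre averages.
theorem TransportInequality.prod {V W : Type*} [AddCommGroup V] [Module ℝ V]
    [MeasurableSpace V] [AddCommGroup W] [Module ℝ W] [MeasurableSpace W]
    {μ : Measure V} {ν : Measure W} [SFinite μ] [SFinite ν] (hμ : TransportInequality μ)
    (hν : TransportInequality ν) : TransportInequality (μ.prod ν) := by
  intro α β H G φ ψ hα hβ hH hG hφ hψ l hl k hk hα1 hβ1 h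
  have hslice : ∀ {f : V × W → ℝ≥0∞}, Measurable f → ∀ v, Measurable fun w => f (v, w) :=
    fun hf v => hf.comp measurable_prodMk_left
  rw [lintegral_prod _ (by fun_prop)] at hα1 hβ1
  have marg : ∀ {f g : V × W → ℝ≥0∞}, Measurable f → Measurable g →
      ∫⁻ v, ∫⁻ w, f (v, w) ∂ν ∂μ = 1 →
      ∫⁻ z, g z * f z ∂(μ.prod ν) = ∫⁻ v, ((∫⁻ w, g (v, w) * f (v, w) ∂ν) / ∫⁻ w, f (v, w) ∂ν) *
        ∫⁻ w, f (v, w) ∂ν ∂μ := by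
    intro f g hf hg h1
    rw [lintegral_prod _ (by fun_prop)]
    have hfin : ∀ᵐ v ∂μ, ∫⁻ w, f (v, w) ∂ν < ∞ :=
      ae_lt_top hf.lintegral_prod_right' (by rw [h1]; simp)
    refine lintegral_congr_ae ?_
    filter_upwards [hfin] with v hv
    by_cases h0 : ∫⁻ w, f (v, w) ∂ν = 0
    · rw [h0, mul_zero]
      rw [lintegral_eq_zero_iff (hslice hf v)] at h0
      refine (lintegral_eq_zero_iff ((hslice hg v).mul (hslice hf v))).2 ?_
      filter_upwards [h0] with w hw
      simp only [Pi.zero_apply, Pi.mul_apply] at hw ⊢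
      rw [hw, mul_zero]
    · rw [ENNReal.div_mul_cancel h0 hv.ne]
  rw [marg hα hφ hα1, marg hβ hψ hβ1, lintegral_prod H (by fun_prop),
    lintegral_prod G (by fun_prop)]
  refine hμ _ _ _ _ _ _ hα.lintegral_prod_right' hβ.lintegral_prod_right'
    hH.lintegral_prod_right' hG.lintegral_prod_right'
    ((hφ.mul hα).lintegral_prod_right'.div hα.lintegral_prod_right')
    ((hψ.mul hβ).lintegral_prod_right'.div hβ.lintegral_prod_right') l hl k hk hα1 hβ1 ?_
  intro a b h1 h2 h3 h4
  refine hν.of_ne_zero (hslice hα a) (hslice hβ b) (hslice hH _) (hslice hG _) (hslice hφ a)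
    (hslice hψ b) hl hk h1 h2 h3 h4 ?_
  intro a' b' h1' h2' h3' h4'
  exact h (a, a') (b, b') h1' h2' h3' h4'

open ENNReal in
theorem TransportInequality.of_measurePreserving {V W : Type*} [AddCommGroup V] [Module ℝ V]
    [MeasurableSpace V] [AddCommGroup W] [Module ℝ W] [MeasurableSpace W]
    {μ : Measure V} {ν : Measure W} (hμ : TransportInequality μ) (e : V →ₗ[ℝ] W)
    (he : MeasurePreserving e μ ν) : TransportInequality ν := by
  intro α β H G φ ψ hα hβ hH hG hφ hψ l hl k hk hα1 hβ1 h
  rw [← he.lintegral_comp (by fun_prop)] at hα1 hβ1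
  rw [← he.lintegral_comp (by fun_prop), ← he.lintegral_comp (by fun_prop),
    ← he.lintegral_comp (by fun_prop), ← he.lintegral_comp (by fun_prop)]
  refine hμ (α ∘ e) (β ∘ e) (H ∘ e) (G ∘ e) (φ ∘ e) (ψ ∘ e) (hα.comp he.measurable)
    (hβ.comp he.measurable) (hH.comp he.measurable) (hG.comp he.measurable)
    (hφ.comp he.measurable) (hψ.comp he.measurable) l hl k hk hα1 hβ1 ?_
  intro a b h1 h2 h3 h4
  simpa using h (e a) (e b) h1 h2 h3 h4

theorem transportInequality_pi (m : ℕ) :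
    TransportInequality (volume : Measure (Fin m → ℝ)) := by
  induction m with
  | zero =>
    intro α β H G φ ψ hα hβ hH hG hφ hψ l hl k hk hα1 hβ1 h
    rw [volume_pi, Measure.pi_of_empty _ 0] at *
    simp only [lintegral_dirac] at *
    have key := h 0 0 (by rw [hα1]; simp) (by rw [hα1]; simp) (by rw [hβ1]; simp)
      (by rw [hβ1]; simp)
    rw [hα1, hβ1]
    simpa only [hα1, hβ1, smul_zero, add_zero, ENNReal.one_rpow, mul_one, div_one] using key
  | succ m ih =>
    refine (transportInequality_real.prod ih).of_measurePreserving
      (Fin.consLinearEquiv ℝ (fun _ : Fin (m + 1) => ℝ)).toLinearMap ?_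
    have e : ((Fin.consLinearEquiv ℝ (fun _ : Fin (m + 1) => ℝ)).toLinearMap :
        ℝ × (Fin m → ℝ) → Fin (m + 1) → ℝ) =
        (MeasurableEquiv.piFinSuccAbove (fun _ : Fin (m + 1) => ℝ) 0).symm := by
      funext p
      exact (Fin.insertNth_zero' (β := ℝ) p.1 p.2).symm
    rw [e]
    exact (volume_preserving_piFinSuccAbove (fun _ : Fin (m + 1) => ℝ) 0).symm

theorem transportInequality_volume (V : Type*) [NormedAddCommGroup V] [InnerProductSpace ℝ V]
    [FiniteDimensional ℝ V] [MeasurableSpace V] [BorelSpace V] :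
    TransportInequality (volume : Measure V) := by
  refine ((transportInequality_pi (finrank ℝ V)).of_measurePreserving
    (WithLp.linearEquiv 2 ℝ (Fin (finrank ℝ V) → ℝ)).symm.toLinearMap
      (PiLp.volume_preserving_toLp _)).of_measurePreserving
    (stdOrthonormalBasis ℝ V).repr.symm.toLinearEquiv.toLinearMap ?_
  exact (stdOrthonormalBasis ℝ V).repr.symm.measurePreserving

open ENNReal in
/-- The transport inequality between a set and its reflection. -/
theorem setLIntegral_le_of_reflection {V : Type*} [NormedAddCommGroup V] [InnerProductSpace ℝ V]
    [FiniteDimensional ℝ V] [MeasurableSpace V] [BorelSpace V] {S : Set V} (hS : MeasurableSet S)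
    (hSfin : volume S ≠ ∞) {f h : V → ℝ≥0∞} (hf : Measurable f) (hh : Measurable h) {τ : ℝ}
    (hτ : τ ∈ Icc (0 : ℝ) 1)
    (hfh : ∀ a ∈ S, ∀ b ∈ S,
      f a + f b ≤ h ((1 - τ) • a - τ • b) + h ((1 - τ) • b - τ • a)) :
    ∫⁻ y in S, f y ≤ ∫⁻ y, h y := by
  by_cases h0 : volume S = 0
  · rw [setLIntegral_measure_zero _ _ h0]; exact zero_le
  have hα : ∫⁻ x, S.indicator (1 : V → ℝ≥0∞) x = volume S := by
    rw [lintegral_indicator_one hS]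
  have hβ : ∫⁻ x, S.indicator (1 : V → ℝ≥0∞) (-x) = volume S := by
    rw [lintegral_neg_eq_self (fun x => S.indicator (1 : V → ℝ≥0∞) x), hα]
  have hfα : ∫⁻ x, f x * S.indicator (1 : V → ℝ≥0∞) x = ∫⁻ y in S, f y := by
    rw [← lintegral_indicator hS]
    congr with x
    by_cases hx : x ∈ S <;> simp [hx]
  have hm : Measurable (S.indicator (1 : V → ℝ≥0∞)) := measurable_one.indicator hS
  -- The densities are the indicators of `S` and `-S`. The weights `τ` and `1 - τ`, with the second
  -- target reflected, produce the two points in `hfh`. After undoing reflections each side is a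
  -- doubled integral.
  have key := (transportInequality_volume V).of_ne_zero (α := S.indicator 1)
    (β := fun x => S.indicator 1 (-x)) (H := h) (G := fun x => h (-x)) (φ := f)
    (ψ := fun x => f (-x)) (l := τ) (k := 1 - τ) hm (hm.comp measurable_neg) hh
    (hh.comp measurable_neg) hf (hf.comp measurable_neg) hτ
    ⟨by linarith [hτ.2], by linarith [hτ.1]⟩ (by rwa [hα]) (by rwa [hα]) (by rwa [hβ])
    (by rwa [hβ]) (by
      intro a b h1 _ h3 _
      have ha : a ∈ S := by by_contra h; simp [h] at h1
      have hb : -b ∈ S := by by_contra h; simp [h] at h3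
      have := hfh a ha (-b) hb
      simp only [ha, hb, indicator_of_mem, Pi.one_apply, ENNReal.one_rpow, mul_one, div_one]
      convert this using 3
      · module
      · module)
  rw [lintegral_neg_eq_self (fun x => f x * S.indicator (1 : V → ℝ≥0∞) x), hα, hβ, hfα,
    lintegral_neg_eq_self (fun x => h x)] at key
  have hp : ∀ r : ℝ, volume S ^ (1 - r) * volume S ^ r = volume S := by
    intro r
    rw [← ENNReal.rpow_add _ _ h0 hSfin]; simp
  rw [hp, hp, ← two_mul, ← two_mul] at key
  have := (ENNReal.mul_le_mul_iff_right (by simp) (by simp)).1 key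
  rwa [ENNReal.div_le_iff h0 hSfin, ENNReal.div_mul_cancel h0 hSfin] at this

theorem lintegral_comp_smul_of_pos {V : Type*} [NormedAddCommGroup V] [NormedSpace ℝ V]
    [FiniteDimensional ℝ V] [MeasurableSpace V] [BorelSpace V] (μ : Measure V)
    [μ.IsAddHaarMeasure] {f : V → ENNReal} (hf : Measurable f) {r : ℝ} (hr : 0 < r) :
    ENNReal.ofReal (r ^ finrank ℝ V) * ∫⁻ y, f (r • y) ∂μ = ∫⁻ y, f y ∂μ := by
  have h1 : ∫⁻ y, f (r • y) ∂μ = ∫⁻ y, f y ∂(μ.map (r • ·)) :=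
    (lintegral_map hf (measurable_const_smul r)).symm
  have h2 : 0 < r ^ finrank ℝ V := by positivity
  rw [h1, Measure.map_addHaar_smul μ hr.ne', lintegral_smul_measure, smul_eq_mul, ← mul_assoc,
    ← ENNReal.ofReal_mul h2.le, abs_of_pos (inv_pos.2 h2), mul_inv_cancel₀ h2.ne',
    ENNReal.ofReal_one, one_mul]

/-! ### Reflected convex combinations. -/

section

variable {E : Type*} [NormedAddCommGroup E] [InnerProductSpace ℝ E] {K : Set E}
  {L : Submodule ℝ E} {p : ℝ}

theorem norm_le_norm_add_of_mem_orthogonal {x y : E} (hx : x ∈ L) (hy : y ∈ Lᗮ) :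
    ‖x‖ ≤ ‖x + y‖ := by
  have h := norm_add_sq_eq_norm_sq_add_norm_sq_of_inner_eq_zero x y
    (L.mem_orthogonal y |>.1 hy x hx)
  nlinarith [norm_nonneg x, norm_nonneg (x + y), norm_nonneg y, mul_self_nonneg ‖y‖]

theorem reflected_combination_mem (hKc : Convex ℝ K) {γ : ℝ} (hγK : γ • (-K) ⊆ K) {t : ℝ}
    (ht0 : 0 ≤ t) (ht1 : t ≤ 1) {P Q : E} (hP : P ∈ K) (hQ : Q ∈ K) :
    (1 - t) • P - (t * γ) • Q ∈ K := by
  have hQ' : γ • (-Q) ∈ K := hγK (Set.smul_mem_smul_set (Set.neg_mem_neg.2 hQ))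
  have := hKc hP hQ' (sub_nonneg.2 ht1) ht0 (by ring)
  convert this using 1
  module

/-- The map `(P, Q) ↦ (u, v)` with `u = (1 - t)P - tγQ` and `v = (1 - t)Q - tγP` is inverted: its
determinant is `(1 - t)² - (tγ)² = s l`, so `l P` and `l Q` are convex combinations of `u` and `v`
with weights `(1 - t)/s` and `tγ/s`. Convexity of `r ↦ r ^ p` is applied to both, and the weights
add up to one in the sum. -/
theorem rpow_norm_reflected_combination {t γ : ℝ} (ht : 0 ≤ t * γ) (hl : 0 < 1 - t * (1 + γ))
    (hp : 1 ≤ p) (P Q : E) :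
    (1 - t * (1 + γ)) ^ p * (‖P‖ ^ p + ‖Q‖ ^ p) ≤
      ‖(1 - t) • P - (t * γ) • Q‖ ^ p + ‖(1 - t) • Q - (t * γ) • P‖ ^ p := by
  set l := 1 - t * (1 + γ) with hldef
  set s := 1 - t * (1 - γ) with hsdef
  have hs : 0 < s := by nlinarith
  have h1t : 0 ≤ 1 - t := by nlinarith
  have aux : ∀ P Q : E, l ^ p * ‖P‖ ^ p ≤
      ((1 - t) / s) * ‖(1 - t) • P - (t * γ) • Q‖ ^ p +
      ((t * γ) / s) * ‖(1 - t) • Q - (t * γ) • P‖ ^ p := by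
    intro P Q
    set u := (1 - t) • P - (t * γ) • Q with hu
    set v := (1 - t) • Q - (t * γ) • P with hv
    have e : l • P = ((1 - t) / s) • u + ((t * γ) / s) • v := by
      have : (s * l) • P = (1 - t) • u + (t * γ) • v := by
        have e2 : s * l = (1 - t) ^ 2 - (t * γ) ^ 2 := by rw [hsdef, hldef]; ring
        rw [e2, hu, hv]; module
      rw [div_eq_inv_mul, div_eq_inv_mul, mul_smul, mul_smul, ← smul_add, ← this, mul_smul,
        inv_smul_smul₀ hs.ne']
    have h1 : l * ‖P‖ ≤ ((1 - t) / s) * ‖u‖ + ((t * γ) / s) * ‖v‖ := by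
      calc l * ‖P‖ = ‖l • P‖ := by rw [norm_smul, Real.norm_of_nonneg hl.le]
        _ ≤ ‖((1 - t) / s) • u‖ + ‖((t * γ) / s) • v‖ := by rw [e]; exact norm_add_le _ _
        _ = _ := by
          rw [norm_smul, norm_smul, Real.norm_of_nonneg (by positivity),
            Real.norm_of_nonneg (by positivity)]
    rw [← Real.mul_rpow hl.le (norm_nonneg _)]
    refine (Real.rpow_le_rpow (by positivity) h1 (by linarith)).trans ?_
    exact (convexOn_rpow hp).2 (norm_nonneg u) (norm_nonneg v) (by positivity) (by positivity)
      (by rw [← add_div, div_eq_one_iff_eq hs.ne', hsdef]; ring)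
  have h1 := aux P Q
  have h2 := aux Q P
  have e : (1 - t) / s + (t * γ) / s = 1 := by
    rw [← add_div, div_eq_one_iff_eq hs.ne', hsdef]; ring
  set U := ‖(1 - t) • P - (t * γ) • Q‖ ^ p
  set W := ‖(1 - t) • Q - (t * γ) • P‖ ^ p
  have e3 : (t * γ) / s = 1 - (1 - t) / s := by linarith
  rw [e3] at h1 h2
  linarith

/-- For `x` in `L` and `y`, `z` in `Lᗮ`, this separates the contracted base point from the fibre
part. Extracting the dilation `s` leaves the interpolation weight `tγ/s` required by
`setLIntegral_le_of_reflection`. -/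
theorem reflection_add_smul {t γ : ℝ} (hs : 0 < 1 - t * (1 - γ)) (x y z : E) :
    (1 - t * (1 + γ)) • x + (1 - t * (1 - γ)) •
      ((1 - t * γ / (1 - t * (1 - γ))) • y - (t * γ / (1 - t * (1 - γ))) • z) =
      (1 - t) • (x + y) - (t * γ) • (x + z) := by
  set s := 1 - t * (1 - γ) with hsdef
  have e1 : s * (1 - t * γ / s) = 1 - t := by field_simp; rw [hsdef]; ring
  have e2 : s * (t * γ / s) = t * γ := by field_simp
  rw [smul_sub, smul_smul, smul_smul, e1, e2]
  module

theorem reflection_weight_mem {t γ : ℝ} (hγ : 0 ≤ γ) (ht : 0 ≤ t) (hl : 0 < 1 - t * (1 + γ)) :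
    t * γ / (1 - t * (1 - γ)) ∈ Icc (0 : ℝ) 1 := by
  have h := mul_nonneg ht hγ
  have hs : 0 < 1 - t * (1 - γ) := by nlinarith
  exact ⟨by positivity, by rw [div_le_one hs]; nlinarith⟩

end

/-! ### Weighted section masses and their lower bounds along rays. -/

section

variable {E : Type*} [NormedAddCommGroup E] [MeasurableSpace E] {K : Set E} {p : ℝ}

/-- The density `z ↦ |z|ᵖ` on `K`, extended by zero. -/
noncomputable def normRpowIndicator (K : Set E) (p : ℝ) (z : E) : ENNReal :=
  K.indicator (fun z => ENNReal.ofReal (‖z‖ ^ p)) z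

theorem measurable_normRpowIndicator [BorelSpace E] (hK : MeasurableSet K) :
    Measurable (normRpowIndicator K p) := by
  refine Measurable.indicator ?_ hK
  fun_prop

variable [InnerProductSpace ℝ E] {L : Submodule ℝ E}

theorem measurableSet_section [BorelSpace E] (hK : MeasurableSet K) (x : E) :
    MeasurableSet {y : Lᗮ | x + (y : E) ∈ K} :=
  hK.preimage (f := fun y : Lᗮ => x + (y : E)) (by fun_prop)

theorem measurable_normRpowIndicator_add [BorelSpace E] (hK : MeasurableSet K) (x : E) (s : ℝ) :
    Measurable fun y : Lᗮ => normRpowIndicator K p (x + s • (y : E)) :=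
  (measurable_normRpowIndicator hK).comp (by fun_prop)

/-- The integral of `|z|ᵖ` over the section of `K` by `x + Lᗮ`, with values in `ℝ≥0∞`. -/
noncomputable def sectionMass [FiniteDimensional ℝ E] [BorelSpace E] (K : Set E)
    (L : Submodule ℝ E) (p : ℝ) (x : E) : ENNReal :=
  ∫⁻ y : Lᗮ, normRpowIndicator K p (x + y)

end

section

variable {E : Type*} [NormedAddCommGroup E] [InnerProductSpace ℝ E] [FiniteDimensional ℝ E]
  [MeasurableSpace E] [BorelSpace E] {K : Set E} {L : Submodule ℝ E} {p : ℝ}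

theorem sectionMass_eq_smul (hK : MeasurableSet K) (x : E) {s : ℝ} (hs : 0 < s) :
    sectionMass K L p x = ENNReal.ofReal (s ^ finrank ℝ Lᗮ) *
      ∫⁻ y : Lᗮ, normRpowIndicator K p (x + s • (y : E)) := by
  have := measurable_normRpowIndicator_add (L := L) (p := p) hK x 1
  simp only [one_smul] at this
  exact (lintegral_comp_smul_of_pos volume this hs).symm

theorem sectionMass_eq_setLIntegral (hK : MeasurableSet K) (x : E) :
    sectionMass K L p x =
      ∫⁻ y in {y : Lᗮ | x + (y : E) ∈ K}, ENNReal.ofReal (‖x + (y : E)‖ ^ p) := by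
  have hm : MeasurableSet {y : Lᗮ | x + (y : E) ∈ K} :=
    hK.preimage (f := fun y : Lᗮ => x + (y : E)) (by fun_prop)
  rw [← lintegral_indicator hm]
  rfl

theorem volume_section_lt_top (hK : Bornology.IsBounded K) (x : E) :
    volume {y : Lᗮ | x + (y : E) ∈ K} < ⊤ := by
  obtain ⟨R, hR⟩ := hK.exists_norm_le
  refine (Bornology.IsBounded.measure_lt_top (isBounded_iff_forall_norm_le.2 ⟨R + ‖x‖, ?_⟩))
  intro y hy
  have := norm_sub_le (x + (y : E)) x
  rw [add_sub_cancel_left] at this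
  exact this.trans (by linarith [hR _ hy])

/-- Sections through dilated points contain dilated sections. -/
theorem ofReal_rpow_mul_sectionMass_le (hKm : MeasurableSet K) (hKc : Convex ℝ K)
    (h0 : (0 : E) ∈ K) (x : E) {r : ℝ} (hr0 : 0 < r) (hr1 : r ≤ 1) :
    ENNReal.ofReal (r ^ (p + finrank ℝ Lᗮ)) * sectionMass K L p x ≤
      sectionMass K L p (r • x) := by
  rw [sectionMass_eq_smul hKm (r • x) hr0, Real.rpow_add hr0, Real.rpow_natCast, mul_comm (r ^ p),
    ENNReal.ofReal_mul (by positivity), mul_assoc]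
  gcongr
  rw [sectionMass, ← lintegral_const_mul' _ _ ENNReal.ofReal_ne_top]
  refine lintegral_mono fun y => ?_
  rw [← smul_add]
  by_cases hy : x + (y : E) ∈ K
  · have : r • (x + (y : E)) ∈ K := hKc.smul_mem_of_zero_mem h0 hy ⟨hr0.le, hr1⟩
    simp only [normRpowIndicator, hy, this, indicator_of_mem]
    rw [← ENNReal.ofReal_mul (by positivity), norm_smul, Real.norm_of_nonneg hr0.le,
      Real.mul_rpow hr0.le (norm_nonneg _)]
  · simp [normRpowIndicator, hy]

/-- Lower bound for the section mass at a contracted point in the convex case `p ≥ 1`. -/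
theorem ofReal_mul_sectionMass_le_of_one_le (hKm : MeasurableSet K) (hKb : Bornology.IsBounded K)
    (hKc : Convex ℝ K) {γ : ℝ} (hγ : 0 ≤ γ) (hγK : γ • (-K) ⊆ K) (hp : 1 ≤ p) (x : E) {t : ℝ}
    (ht : 0 ≤ t) (hl : 0 < 1 - t * (1 + γ)) :
    ENNReal.ofReal ((1 - t * (1 - γ)) ^ finrank ℝ Lᗮ * (1 - t * (1 + γ)) ^ p) *
      sectionMass K L p x ≤ sectionMass K L p ((1 - t * (1 + γ)) • x) := by
  have htγ := mul_nonneg ht hγ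
  have hs : 0 < 1 - t * (1 - γ) := by nlinarith
  have ht1 : t ≤ 1 := by nlinarith
  -- Dilating the fibre by `s` accounts for the factor `s ^ dim Lᗮ`; only the factor `l ^ p` remains
  -- to be gained pointwise.
  rw [sectionMass_eq_smul hKm ((1 - t * (1 + γ)) • x) hs, ENNReal.ofReal_mul (by positivity), mul_assoc]
  refine mul_le_mul' le_rfl ?_
  rw [sectionMass_eq_setLIntegral hKm, ← lintegral_const_mul' _ _ ENNReal.ofReal_ne_top]
  refine setLIntegral_le_of_reflection (measurableSet_section hKm x)
    (volume_section_lt_top hKb x).ne (by fun_prop) (measurable_normRpowIndicator_add hKm _ _)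
    (reflection_weight_mem hγ ht hl) fun a ha b hb => ?_
  simp only [Submodule.coe_sub, Submodule.coe_smul, reflection_add_smul hs]
  have h1 := reflected_combination_mem hKc hγK ht ht1 ha hb
  have h2 := reflected_combination_mem hKc hγK ht ht1 hb ha
  simp only [normRpowIndicator, h1, h2, indicator_of_mem]
  rw [← ENNReal.ofReal_mul (by positivity), ← ENNReal.ofReal_mul (by positivity),
    ← ENNReal.ofReal_add (by positivity) (by positivity),
    ← ENNReal.ofReal_add (by positivity) (by positivity), ← mul_add]
  exact ENNReal.ofReal_le_ofReal (rpow_norm_reflected_combination htγ hl hp _ _)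

/-- Lower bound for the section mass at a contracted point in the decreasing case `p ≤ 0`. -/
theorem ofReal_mul_sectionMass_le_of_nonpos (hKm : MeasurableSet K) (hKb : Bornology.IsBounded K)
    (hKc : Convex ℝ K) {γ : ℝ} (hγ : 0 ≤ γ) (hγK : γ • (-K) ⊆ K) (hp : p ≤ 0) {x : E}
    (hx : x ∈ L) (hx0 : x ≠ 0) {t : ℝ} (ht : 0 ≤ t) (hl : 0 < 1 - t * (1 + γ)) :
    ENNReal.ofReal ((1 - t * (1 - γ)) ^ (p + finrank ℝ Lᗮ)) *
      sectionMass K L p x ≤ sectionMass K L p ((1 - t * (1 + γ)) • x) := by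
  have htγ := mul_nonneg ht hγ
  have hs : 0 < 1 - t * (1 - γ) := by nlinarith
  have ht1 : t ≤ 1 := by nlinarith
  set l := 1 - t * (1 + γ)
  set s := 1 - t * (1 - γ) with hsdef
  rw [sectionMass_eq_smul hKm (l • x) hs, Real.rpow_add hs, Real.rpow_natCast, mul_comm (s ^ p),
    ENNReal.ofReal_mul (by positivity), mul_assoc]
  refine mul_le_mul' le_rfl ?_
  have hpre : MeasurableSet {y : Lᗮ | l • x + s • (y : E) ∈ K} :=
    hKm.preimage (f := fun y : Lᗮ => l • x + s • (y : E)) (by fun_prop)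
  have e1 : ∫⁻ y : Lᗮ, normRpowIndicator K p (l • x + s • (y : E)) =
      ∫⁻ y in {y : Lᗮ | l • x + s • (y : E) ∈ K},
        ENNReal.ofReal (‖l • x + s • (y : E)‖ ^ p) := by
    rw [← lintegral_indicator hpre]; rfl
  rw [sectionMass_eq_setLIntegral hKm, e1, ← lintegral_const_mul' _ _ ENNReal.ofReal_ne_top]
  simp_rw [← ENNReal.ofReal_mul (Real.rpow_nonneg hs.le p)]
  -- Layer cake on both sides: it suffices to compare the volumes of superlevel sets at each height
  -- `c`.
  rw [lintegral_eq_lintegral_meas_le _ (Filter.Eventually.of_forall fun y => by positivity)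
      (by fun_prop),
    lintegral_eq_lintegral_meas_le _ (Filter.Eventually.of_forall fun y => by positivity)
      (by fun_prop)]
  refine lintegral_mono fun c => ?_
  have hm1 : MeasurableSet {y : Lᗮ | c ≤ s ^ p * ‖x + (y : E)‖ ^ p} :=
    measurableSet_le measurable_const (by fun_prop)
  have hm2 : MeasurableSet {y : Lᗮ | c ≤ ‖l • x + s • (y : E)‖ ^ p} :=
    measurableSet_le measurable_const (by fun_prop)
  rw [Measure.restrict_apply hm1, Measure.restrict_apply hm2, ← setLIntegral_one,
    ← lintegral_indicator_one (hm2.inter hpre)]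
  have hfin : volume ({y : Lᗮ | c ≤ s ^ p * ‖x + (y : E)‖ ^ p} ∩ {y : Lᗮ | x + (y : E) ∈ K}) ≠ ⊤ :=
    ((measure_mono inter_subset_right).trans_lt (volume_section_lt_top hKb x)).ne
  refine setLIntegral_le_of_reflection (hm1.inter (measurableSet_section hKm x)) hfin
    measurable_const (measurable_one.indicator (hm2.inter hpre))
    (reflection_weight_mem hγ ht hl) fun a ha b hb => ?_
  have key : ∀ a ∈ {y : Lᗮ | c ≤ s ^ p * ‖x + (y : E)‖ ^ p} ∩ {y : Lᗮ | x + (y : E) ∈ K},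
      ∀ b ∈ {y : Lᗮ | c ≤ s ^ p * ‖x + (y : E)‖ ^ p} ∩ {y : Lᗮ | x + (y : E) ∈ K},
      (1 - t * γ / s) • a - (t * γ / s) • b ∈ {y : Lᗮ | c ≤ ‖l • x + s • (y : E)‖ ^ p} ∩
        {y : Lᗮ | l • x + s • (y : E) ∈ K} := by
    intro a ha b hb
    have e := reflection_add_smul hs x (a : E) (b : E)
    simp only [mem_inter_iff, mem_ofPred_eq, Submodule.coe_sub, Submodule.coe_smul]
    -- Monotonicity of `r ↦ r ^ p` for `p ≤ 0` fails at the default value of `0 ^ p`. The component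
    -- `l • x ≠ 0` in `L` keeps the norm positive.
    have hpos : 0 < ‖l • x + s • (((1 - t * γ / s) • a - (t * γ / s) • b : Lᗮ) : E)‖ := by
      refine lt_of_lt_of_le ?_ (norm_le_norm_add_of_mem_orthogonal (L.smul_mem l hx)
        (Lᗮ.smul_mem s (Subtype.coe_prop _)))
      exact norm_pos_iff.2 (smul_ne_zero hl.ne' hx0)
    simp only [Submodule.coe_sub, Submodule.coe_smul] at hpos
    rw [e] at hpos ⊢
    refine ⟨?_, reflected_combination_mem hKc hγK ht ht1 ha.2 hb.2⟩
    have hle : ‖(1 - t) • (x + (a : E)) - (t * γ) • (x + (b : E))‖ ≤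
        s * max ‖x + (a : E)‖ ‖x + (b : E)‖ := by
      refine (norm_sub_le _ _).trans ?_
      rw [norm_smul, norm_smul, Real.norm_of_nonneg (sub_nonneg.2 ht1), Real.norm_of_nonneg htγ,
        show s = (1 - t) + t * γ by rw [hsdef]; ring, add_mul]
      exact add_le_add (mul_le_mul_of_nonneg_left (le_max_left _ _) (sub_nonneg.2 ht1))
        (mul_le_mul_of_nonneg_left (le_max_right _ _) htγ)
    refine le_trans ?_ (Real.rpow_le_rpow_of_nonpos hpos hle hp)
    rw [Real.mul_rpow hs.le (le_max_of_le_left (norm_nonneg _))]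
    rcases max_choice ‖x + (a : E)‖ ‖x + (b : E)‖ with h | h <;> rw [h]
    · exact ha.1
    · exact hb.1
  rw [indicator_of_mem (key a ha b hb), indicator_of_mem (key b hb a ha)]
  rfl

end

/-! ### Local Lipschitz continuity and differentiability almost everywhere. -/

theorem exists_rpow_lipschitz_bound (p R : ℝ) {c : ℝ} (hc : 0 < c) :
    ∃ M : ℝ, 0 ≤ M ∧ ∀ a ∈ Icc c R, ∀ b ∈ Icc c R, a ^ p ≤ M ∧ |a ^ p - b ^ p| ≤ M * |a - b| := by
  have h1 : ContinuousOn (fun r : ℝ => r ^ p) (Icc c R) := fun r hr =>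
    (Real.continuousAt_rpow_const _ _ (Or.inl (hc.trans_le hr.1).ne')).continuousWithinAt
  have h2 : ContinuousOn (fun r : ℝ => p * r ^ (p - 1)) (Icc c R) := fun r hr =>
    ((Real.continuousAt_rpow_const _ _
      (Or.inl (hc.trans_le hr.1).ne')).const_mul p).continuousWithinAt
  obtain ⟨M1, hM1⟩ := isCompact_Icc.exists_bound_of_continuousOn h1
  obtain ⟨M2, hM2⟩ := isCompact_Icc.exists_bound_of_continuousOn h2
  refine ⟨max (max M1 M2) 0, le_max_right _ _, fun a ha b hb => ⟨?_, ?_⟩⟩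
  · exact (le_abs_self _).trans ((hM1 a ha).trans ((le_max_left _ _).trans (le_max_left _ _)))
  · have := (convex_Icc c R).norm_image_sub_le_of_norm_hasDerivWithin_le
      (f := fun r : ℝ => r ^ p) (f' := fun r : ℝ => p * r ^ (p - 1)) (C := max (max M1 M2) 0)
      (fun r hr => (Real.hasDerivAt_rpow_const
        (Or.inl (hc.trans_le hr.1).ne')).hasDerivWithinAt)
      (fun r hr => (hM2 r hr).trans ((le_max_right _ _).trans (le_max_left _ _))) hb ha
    simpa using this

section

variable {E : Type*} [NormedAddCommGroup E] [InnerProductSpace ℝ E] [FiniteDimensional ℝ E]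
  [MeasurableSpace E] [BorelSpace E] {K : Set E} {L : Submodule ℝ E} {p : ℝ}

theorem volume_section_le {R : ℝ} (hR : ∀ z ∈ K, ‖z‖ ≤ R) {x : E} (hx : x ∈ L) :
    volume {y : Lᗮ | x + (y : E) ∈ K} ≤ volume (Metric.closedBall (0 : Lᗮ) R) := by
  refine measure_mono fun y hy => ?_
  rw [mem_closedBall_zero_iff]
  have : ‖(y : E)‖ ≤ ‖(y : E) + x‖ := norm_le_norm_add_of_mem_orthogonal (L := Lᗮ) y.2
    (L.le_orthogonal_orthogonal hx)
  rw [add_comm] at this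
  exact this.trans (hR _ hy)

theorem sectionMass_le (hKm : MeasurableSet K) {R : ℝ} (hR : ∀ z ∈ K, ‖z‖ ≤ R) {x : E}
    (hx : x ∈ L) {M : ℝ} (hM : ∀ r ∈ Icc ‖x‖ R, r ^ p ≤ M) :
    sectionMass K L p x ≤ ENNReal.ofReal M * volume (Metric.closedBall (0 : Lᗮ) R) := by
  rw [sectionMass_eq_setLIntegral hKm]
  calc _ ≤ ∫⁻ y in {y : Lᗮ | x + (y : E) ∈ K}, ENNReal.ofReal M := by
        refine setLIntegral_mono measurable_const fun y hy => ENNReal.ofReal_le_ofReal ?_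
        exact hM _ ⟨norm_le_norm_add_of_mem_orthogonal hx y.2, hR _ hy⟩
    _ ≤ _ := by
        rw [setLIntegral_const]
        exact mul_le_mul' le_rfl (volume_section_le hR hx)

theorem sectionMass_lt_top (hKm : MeasurableSet K) (hKb : Bornology.IsBounded K) {x : E}
    (hx : x ∈ L) (hx0 : x ≠ 0) : sectionMass K L p x < ⊤ := by
  obtain ⟨R, hR⟩ := hKb.exists_norm_le
  obtain ⟨M, -, hM⟩ := exists_rpow_lipschitz_bound p R (norm_pos_iff.2 hx0)
  exact (sectionMass_le hKm hR hx fun r hr => (hM r hr r hr).1).trans_lt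
    (ENNReal.mul_lt_top ENNReal.ofReal_lt_top Metric.isBounded_closedBall.measure_lt_top)

/-- Comparison of section masses at a point and at a convex combination of it with another point
of the projection. -/
theorem pow_mul_sectionMass_le_add (hKm : MeasurableSet K) (hKc : Convex ℝ K) {R : ℝ}
    (hR : ∀ z ∈ K, ‖z‖ ≤ R) {x x' w v : E} (hx : x ∈ L) (hx' : x' ∈ L) (hv : v ∈ Lᗮ)
    (hwv : w + v ∈ K) {c M t : ℝ} (hM0 : 0 ≤ M)
    (hM : ∀ a ∈ Icc c R, ∀ b ∈ Icc c R, a ^ p ≤ M ∧ |a ^ p - b ^ p| ≤ M * |a - b|)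
    (hcx : c ≤ ‖x‖) (hcx' : c ≤ ‖x'‖) (ht0 : 0 ≤ t) (ht1 : t < 1)
    (hxw : x' = (1 - t) • x + t • w) :
    ENNReal.ofReal ((1 - t) ^ finrank ℝ Lᗮ) * sectionMass K L p x ≤
      sectionMass K L p x' +
        ENNReal.ofReal (2 * R * M * t) * volume (Metric.closedBall (0 : Lᗮ) R) := by
  have hs : 0 < 1 - t := by linarith
  have hR0 : 0 ≤ R := (norm_nonneg _).trans (hR _ hwv)
  -- The fibre over `x'` is translated by `t • v` and dilated by `1 - t`, so that the fibre over
  -- `x`, moved towards `w + v`, lands in it.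
  have e1 : sectionMass K L p x' = ENNReal.ofReal ((1 - t) ^ finrank ℝ Lᗮ) *
      ∫⁻ y : Lᗮ, normRpowIndicator K p ((x' + t • v) + (1 - t) • (y : E)) := by
    rw [← sectionMass_eq_smul hKm _ hs, sectionMass, sectionMass,
      ← lintegral_add_right_eq_self _ (t • (⟨v, hv⟩ : Lᗮ))]
    refine lintegral_congr fun y => ?_
    congr 1
    simp only [Submodule.coe_add, Submodule.coe_smul]
    abel
  have hmeas := measurable_normRpowIndicator_add (L := L) (p := p) hKm (x' + t • v) (1 - t)
  have hms := measurableSet_section (L := L) hKm x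
  have e2 : sectionMass K L p x ≤
      (∫⁻ y : Lᗮ, normRpowIndicator K p ((x' + t • v) + (1 - t) • (y : E))) +
        ENNReal.ofReal (2 * R * M * t) * volume (Metric.closedBall (0 : Lᗮ) R) := by
    calc sectionMass K L p x ≤ ∫⁻ y in {y : Lᗮ | x + (y : E) ∈ K},
          (normRpowIndicator K p ((x' + t • v) + (1 - t) • (y : E)) +
            ENNReal.ofReal (2 * R * M * t)) := by
          rw [sectionMass_eq_setLIntegral hKm]
          refine setLIntegral_mono (hmeas.add_const _) fun y hy => ?_
          have e : x' + t • v + (1 - t) • (y : E) = (1 - t) • (x + y) + t • (w + v) := by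
            rw [hxw]; module
          have hmem : x' + t • v + (1 - t) • (y : E) ∈ K := by
            rw [e]; exact hKc hy hwv hs.le ht0 (by ring)
          have hb1 : ‖x + (y : E)‖ ∈ Icc c R :=
            ⟨hcx.trans (norm_le_norm_add_of_mem_orthogonal hx y.2), hR _ hy⟩
          have hb2 : ‖x' + t • v + (1 - t) • (y : E)‖ ∈ Icc c R := by
            refine ⟨hcx'.trans ?_, hR _ hmem⟩
            rw [add_assoc]
            exact norm_le_norm_add_of_mem_orthogonal hx'
              (Lᗮ.add_mem (Lᗮ.smul_mem _ hv) (Lᗮ.smul_mem _ y.2))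
          simp only [normRpowIndicator, hmem, indicator_of_mem]
          rw [← ENNReal.ofReal_add (by positivity) (by positivity)]
          refine ENNReal.ofReal_le_ofReal ?_
          have h1 := (hM _ hb1 _ hb2).2
          have h2 : |‖x + (y : E)‖ - ‖x' + t • v + (1 - t) • (y : E)‖| ≤ t * (2 * R) := by
            refine (abs_norm_sub_norm_le _ _).trans ?_
            have : x + (y : E) - (x' + t • v + (1 - t) • (y : E)) =
                t • ((x + y) - (w + v)) := by rw [e]; module
            rw [this, norm_smul, Real.norm_of_nonneg ht0]
            refine mul_le_mul_of_nonneg_left ?_ ht0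
            exact (norm_sub_le _ _).trans (by linarith [hR _ hy, hR _ hwv])
          have h3 := (le_abs_self _).trans (h1.trans (mul_le_mul_of_nonneg_left h2 hM0))
          linarith
      _ ≤ _ := by
          rw [lintegral_add_left hmeas, setLIntegral_const]
          exact add_le_add (setLIntegral_le_lintegral _ _)
            (mul_le_mul' le_rfl (volume_section_le hR hx))
  rw [e1]
  calc _ ≤ ENNReal.ofReal ((1 - t) ^ finrank ℝ Lᗮ) * _ := mul_le_mul' le_rfl e2
    _ ≤ _ := by
      rw [mul_add]
      refine add_le_add le_rfl (mul_le_of_le_one_left zero_le ?_)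
      rw [ENNReal.ofReal_le_one]
      exact pow_le_one₀ hs.le (by linarith)

/-- The segment from `x` to `x'` is prolonged by length `δ` to a point `w` still in the projection.
Then `x'` is a convex combination of `x` and `w` with weight `t = O(|x - x'|)` on `w`, and
`pow_mul_sectionMass_le_add` applies. The point `x₀` must be nonzero because the weight may be
singular at the origin. -/
theorem exists_lipschitzOnWith_sectionMass (hKm : MeasurableSet K)
    (hKb : Bornology.IsBounded K) (hKc : Convex ℝ K) {x₀ : L} (hx₀ : x₀ ≠ 0)
    (hint : x₀ ∈ interior ((fun z => L.orthogonalProjectionOnto z) '' K)) :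
    ∃ C, ∃ U ∈ nhds x₀, LipschitzOnWith C (fun x : L => (sectionMass K L p x).toReal) U := by
  obtain ⟨R, hR⟩ := hKb.exists_norm_le
  have hx₀' : 0 < ‖x₀‖ := norm_pos_iff.2 hx₀
  obtain ⟨M, hM0, hM⟩ := exists_rpow_lipschitz_bound p R (half_pos hx₀')
  obtain ⟨ε, hε, hball⟩ := Metric.mem_nhds_iff.1 (mem_interior_iff_mem_nhds.1 hint)
  set δ := min (ε / 2) (‖x₀‖ / 2) with hδ
  have hδ0 : 0 < δ := lt_min (half_pos hε) (half_pos hx₀')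
  have hδ1 : 2 * δ ≤ ε := by linarith [min_le_left (ε / 2) (‖x₀‖ / 2)]
  have hδ2 : δ ≤ ‖x₀‖ / 2 := min_le_right _ _
  set V := (volume (Metric.closedBall (0 : Lᗮ) R)).toReal with hV
  have hVtop : volume (Metric.closedBall (0 : Lᗮ) R) ≠ ⊤ :=
    Metric.isBounded_closedBall.measure_lt_top.ne
  have hV0 : 0 ≤ V := ENNReal.toReal_nonneg
  have hnorm : ∀ x ∈ Metric.ball x₀ δ, ‖x₀‖ / 2 ≤ ‖(x : E)‖ := by
    intro x hx
    rw [Metric.mem_ball, dist_eq_norm] at hx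
    have := norm_sub_norm_le x₀ x
    rw [norm_sub_rev] at this
    rw [← Submodule.coe_norm]
    linarith
  have hne : ∀ x ∈ Metric.ball x₀ δ, (x : E) ≠ 0 := fun x hx =>
    norm_pos_iff.1 ((half_pos hx₀').trans_le (hnorm x hx))
  set g : L → ℝ := fun x => (sectionMass K L p x).toReal with hg
  -- The first term is the loss from `(1 - t) ^ dim Lᗮ` by Bernoulli's inequality, the second the
  -- variation of the weight. The denominator comes from `t ≤ r / δ`.
  set C := (finrank ℝ Lᗮ * (M * V) + 2 * |R| * M * V) / δ with hC
  have hC0 : 0 ≤ C := by positivity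
  have key : ∀ x ∈ Metric.ball x₀ δ, ∀ x' ∈ Metric.ball x₀ δ, g x ≤ g x' + C * dist x x' := by
    intro x hx x' hx'
    rcases eq_or_ne x x' with rfl | hxx
    · simp
    have hr : 0 < ‖x' - x‖ := norm_pos_iff.2 (sub_ne_zero.2 hxx.symm)
    set r := ‖x' - x‖ with hrdef
    set w : L := x' + (δ / r) • (x' - x) with hw
    have hwb : w ∈ Metric.ball x₀ ε := by
      rw [Metric.mem_ball, dist_eq_norm] at hx' ⊢
      have : w - x₀ = (x' - x₀) + (δ / r) • (x' - x) := by rw [hw]; abel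
      rw [this]
      refine (norm_add_le _ _).trans_lt ?_
      rw [norm_smul, Real.norm_of_nonneg (by positivity), ← hrdef, div_mul_cancel₀ _ hr.ne']
      linarith
    obtain ⟨z, hz, hzw⟩ := hball hwb
    have hv : z - (w : E) ∈ Lᗮ := by
      rw [← hzw]
      exact L.sub_starProjection_mem_orthogonal z
    have hwv : (w : E) + (z - w) ∈ K := by simpa using hz
    have hRnn : 0 ≤ R := (norm_nonneg _).trans (hR _ hz)
    set t := r / (r + δ) with ht
    have hrd : 0 < r + δ := by positivity
    have ht0 : 0 ≤ t := by positivity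
    have ht1 : t < 1 := by rw [ht, div_lt_one hrd]; linarith
    have htr : t ≤ r / δ := div_le_div_of_nonneg_left hr.le hδ0 (by linarith)
    have hxw : (x' : E) = (1 - t) • (x : E) + t • (w : E) := by
      have e1 : t * (δ / r) = 1 - t := by rw [ht]; field_simp; ring
      have : x' = (1 - t) • x + t • w := by
        rw [hw, smul_add, smul_smul, e1]; module
      exact congrArg Subtype.val this
    have main := pow_mul_sectionMass_le_add (p := p) hKm hKc hR x.2 x'.2 hv hwv hM0 hM
      (hnorm x hx) (hnorm x' hx') ht0 ht1 hxw
    have hfx := (sectionMass_lt_top (p := p) hKm hKb x.2 (hne x hx)).ne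
    have hfx' := (sectionMass_lt_top (p := p) hKm hKb x'.2 (hne x' hx')).ne
    have main' : (1 - t) ^ finrank ℝ Lᗮ * g x ≤ g x' + 2 * R * M * t * V := by
      have := ENNReal.toReal_mono (ENNReal.add_ne_top.2 ⟨hfx', ENNReal.mul_ne_top
        ENNReal.ofReal_ne_top hVtop⟩) main
      rwa [ENNReal.toReal_add hfx' (ENNReal.mul_ne_top ENNReal.ofReal_ne_top hVtop),
        ENNReal.toReal_mul, ENNReal.toReal_mul, ENNReal.toReal_ofReal (pow_nonneg (by linarith) _),
        ENNReal.toReal_ofReal (by positivity)] at this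
    have hgx : g x ≤ M * V := by
      have := ENNReal.toReal_mono (ENNReal.mul_ne_top ENNReal.ofReal_ne_top hVtop)
        (sectionMass_le (p := p) hKm hR x.2 (M := M) fun r hr =>
          (hM r ⟨(hnorm x hx).trans hr.1, hr.2⟩ r ⟨(hnorm x hx).trans hr.1, hr.2⟩).1)
      rwa [ENNReal.toReal_mul, ENNReal.toReal_ofReal hM0] at this
    have hg0 : 0 ≤ g x := ENNReal.toReal_nonneg
    have bern := one_add_mul_le_pow (a := -t) (by linarith) (finrank ℝ Lᗮ)
    have h1 : (1 - finrank ℝ Lᗮ * t) * g x ≤ (1 - t) ^ finrank ℝ Lᗮ * g x := by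
      refine mul_le_mul_of_nonneg_right ?_ hg0
      rw [show (1 - t) = 1 + -t by ring]
      linarith
    have h2 : finrank ℝ Lᗮ * t * g x ≤ finrank ℝ Lᗮ * t * (M * V) :=
      mul_le_mul_of_nonneg_left hgx (by positivity)
    have h3 : (finrank ℝ Lᗮ * (M * V) + 2 * |R| * M * V) * t ≤ C * r := by
      rw [hC, div_mul_eq_mul_div, mul_div_assoc]
      exact mul_le_mul_of_nonneg_left htr (by positivity)
    rw [abs_of_nonneg hRnn] at h3
    rw [dist_comm, dist_eq_norm]
    linarith
  refine ⟨⟨C, hC0⟩, Metric.ball x₀ δ, Metric.ball_mem_nhds _ hδ0, ?_⟩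
  refine LipschitzOnWith.of_dist_le_mul fun x hx x' hx' => ?_
  rw [Real.dist_eq, abs_le]
  have h1 := key x hx x' hx'
  have h2 := key x' hx' x hx
  rw [dist_comm] at h2
  change -(C * dist x x') ≤ g x - g x' ∧ g x - g x' ≤ C * dist x x'
  constructor <;> linarith

/-- Rademacher's theorem applies locally in the interior of the projection away from `0`. The
frontier of a convex set is null, and so is the origin since `L` is nontrivial. -/
theorem ae_differentiableAt_sectionMass [Nontrivial L] (hKm : MeasurableSet K)
    (hKb : Bornology.IsBounded K) (hKc : Convex ℝ K) :
    ∀ᵐ x ∂(volume.restrict ((fun z => L.orthogonalProjectionOnto z) '' K)),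
      DifferentiableAt ℝ (fun x : L => (sectionMass K L p x).toReal) x := by
  set P : Set L := (fun z => L.orthogonalProjectionOnto z) '' K with hP
  have hPc : Convex ℝ P := hKc.linear_image L.orthogonalProjectionOnto.toLinearMap
  set g : L → ℝ := fun x : L => (sectionMass K L p x).toReal with hg
  set D : Set L := {x | DifferentiableAt ℝ g x}
  have hDm : MeasurableSet D := measurableSet_of_differentiableAt ℝ g
  have h1 : volume ((interior P \ {0}) \ D) = 0 := by
    refine measure_null_of_locally_null _ fun x hx => ?_
    obtain ⟨C, U, hU, hL⟩ := exists_lipschitzOnWith_sectionMass (p := p) hKm hKb hKc hx.1.2 hx.1.1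
    refine ⟨interior U \ D, ?_, ?_⟩
    · exact Filter.inter_mem (mem_nhdsWithin_of_mem_nhds (interior_mem_nhds.2 hU))
        (Filter.mem_of_superset self_mem_nhdsWithin fun y hy => hy.2)
    · have := (hL.mono interior_subset).ae_differentiableWithinAt_of_mem (μ := volume)
      refine measure_mono_null (fun y hy => ?_) (ae_iff.1 this)
      intro h
      exact hy.2 ((h hy.1).differentiableAt (isOpen_interior.mem_nhds hy.1))
  rw [ae_restrict_iff hDm, ae_iff]
  refine measure_mono_null (t := ((interior P \ {0}) \ D) ∪ frontier P ∪ {0}) ?_ ?_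
  · intro x hx
    simp only [mem_ofPred_eq, Classical.not_imp] at hx
    by_cases h0 : x = 0
    · exact Or.inr h0
    by_cases hi : x ∈ interior P
    · exact Or.inl (Or.inl ⟨⟨hi, h0⟩, hx.2⟩)
    · exact Or.inl (Or.inr ⟨subset_closure hx.1, hi⟩)
  · rw [measure_union_null_iff, measure_union_null_iff]
    exact ⟨⟨h1, hPc.addHaar_frontier volume⟩, measure_singleton _⟩

end

/-! ### The total mass: Fubini and polar coordinates. -/

theorem lintegral_sectionMass {E : Type*} [NormedAddCommGroup E] [InnerProductSpace ℝ E]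
    [FiniteDimensional ℝ E] [MeasurableSpace E] [BorelSpace E] {K : Set E}
    (hK : MeasurableSet K) (L : Submodule ℝ E) (p : ℝ) :
    ∫⁻ x : L, sectionMass K L p x = ∫⁻ z, normRpowIndicator K p z := by
  have h := (L.measurePreserving_measurableEquivProd (0 : E)).symm
  rw [InnerProductSpace.euclideanHausdorffMeasure_eq_volume] at h
  have hm := measurable_normRpowIndicator (p := p) hK
  rw [← h.lintegral_comp hm, Measure.volume_eq_prod,
    lintegral_prod (fun w => normRpowIndicator K p ((L.measurableEquivProd (0 : E)).symm w))
      (hm.comp h.measurable).aemeasurable]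
  simp only [Submodule.measurableEquivProd_symm_apply, vadd_eq_add, add_zero]
  rfl

section

variable {n : ℕ} {K : Set (E5 n)}

theorem setOf_pos_smul_mem_eq_Ioc (hKc : IsCompact K) (hKconv : Convex ℝ K)
    (h0 : (0 : E5 n) ∈ interior K) {u : E5 n} (hu : ‖u‖ = 1) :
    0 < radialFunction K u ∧
      {r : ℝ | 0 < r ∧ r • u ∈ K} = Ioc 0 (radialFunction K u) := by
  set S := {r : ℝ | 0 < r ∧ r • u ∈ K} with hS
  obtain ⟨ε, hε, hball⟩ := Metric.mem_nhds_iff.1 (mem_interior_iff_mem_nhds.1 h0)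
  have hmem : ε / 2 ∈ S := by
    refine ⟨half_pos hε, hball ?_⟩
    rw [mem_ball_zero_iff, norm_smul, hu, Real.norm_of_nonneg (by positivity)]
    linarith
  obtain ⟨R, hR⟩ := hKc.isBounded.exists_norm_le
  have hbdd : BddAbove S := by
    refine ⟨R, fun r hr => ?_⟩
    have := hR _ hr.2
    rwa [norm_smul, hu, mul_one, Real.norm_of_nonneg hr.1.le] at this
  have hpos : 0 < sSup S := (half_pos hε).trans_le (le_csSup hbdd hmem)
  have hcl : sSup S • u ∈ K := by
    have hc : IsClosed {r : ℝ | r • u ∈ K} := hKc.isClosed.preimage (by fun_prop)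
    exact hc.closure_subset_iff.2 (fun r hr => hr.2) (csSup_mem_closure ⟨_, hmem⟩ hbdd)
  refine ⟨hpos, Subset.antisymm (fun r hr => ⟨hr.1, le_csSup hbdd hr⟩) fun r hr => ⟨hr.1, ?_⟩⟩
  change r ∈ Ioc 0 (sSup S) at hr
  have := hKconv.smul_mem_of_zero_mem (interior_subset h0) hcl
    (t := r / sSup S) ⟨div_nonneg hr.1.le hpos.le, (div_le_one hpos).2 hr.2⟩
  rwa [smul_smul, div_mul_cancel₀ _ hpos.ne'] at this

/-- Every boundary point has an outer normal: separate it from the interior of `K` by Hahn–Banach,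
pass to the closure, and normalize the Riesz representative. -/
theorem reverseRadialGaussImage_univ (hKc : IsCompact K) (hKconv : Convex ℝ K)
    (h0 : (0 : E5 n) ∈ interior K) : reverseRadialGaussImage K univ = univ := by
  refine eq_univ_of_forall fun u => ?_
  have hu : ‖(u : E5 n)‖ = 1 := by simp
  obtain ⟨hpos, hIoc⟩ := setOf_pos_smul_mem_eq_Ioc hKc hKconv h0 hu
  set z := radialFunction K (u : E5 n) • (u : E5 n) with hz
  have hzK : z ∈ K := by
    have : radialFunction K (u : E5 n) ∈ {r : ℝ | 0 < r ∧ r • (u : E5 n) ∈ K} := by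
      rw [hIoc]; exact ⟨hpos, le_rfl⟩
    exact this.2
  have hznot : z ∉ interior K := by
    intro hzi
    have hcont : Continuous fun r : ℝ => r • (u : E5 n) := by fun_prop
    have hnh : ∀ᶠ r in nhdsWithin (radialFunction K (u : E5 n)) (Ioi (radialFunction K (u : E5 n))),
        r • (u : E5 n) ∈ K :=
      (hcont.tendsto _).mono_left nhdsWithin_le_nhds (mem_interior_iff_mem_nhds.1 hzi)
    obtain ⟨r, hr, hr2⟩ := (hnh.and self_mem_nhdsWithin).exists
    have : r ∈ Ioc 0 (radialFunction K (u : E5 n)) := by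
      rw [← hIoc]; exact ⟨hpos.trans hr2, hr⟩
    exact absurd this.2 (not_le.2 hr2)
  obtain ⟨f, hf⟩ := geometric_hahn_banach_open_point hKconv.interior isOpen_interior hznot
  have hfK : ∀ a ∈ K, f a ≤ f z := by
    intro a ha
    have hcl : a ∈ closure (interior K) := by
      rw [Convex.closure_interior_eq_closure_of_nonempty_interior hKconv ⟨0, h0⟩]
      exact subset_closure ha
    have hc : IsClosed {a | f a ≤ f z} := isClosed_le f.continuous continuous_const
    exact hc.closure_subset_iff.2 (fun a ha => (hf a ha).le) hcl
  set v := (InnerProductSpace.toDual ℝ (E5 n)).symm f with hv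
  have hvin : ∀ a, inner ℝ v a = f a := fun a => InnerProductSpace.toDual_symm_apply
  have hv0 : 0 < ‖v‖ := by
    rw [norm_pos_iff]
    intro h
    have h1 := hf 0 h0
    rw [← hvin, ← hvin, h] at h1
    simp at h1
  refine ⟨⟨‖v‖⁻¹ • v, ?_⟩, mem_univ _, ?_⟩
  · rw [mem_sphere_zero_iff_norm, norm_smul, norm_inv, norm_norm, inv_mul_cancel₀ hv0.ne']
  · have hg : IsGreatest ((fun x => inner ℝ (‖v‖⁻¹ • v) x) '' K) (inner ℝ (‖v‖⁻¹ • v) z) := by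
      refine ⟨⟨z, hzK, rfl⟩, ?_⟩
      rintro _ ⟨a, ha, rfl⟩
      simp only [inner_smul_left, hvin]
      exact mul_le_mul_of_nonneg_left (hfK a ha) (by simp)
    exact hg.csSup_eq.symm

theorem lintegral_volumeIoiPow_normRpowIndicator (hKc : IsCompact K) (hKconv : Convex ℝ K)
    (h0 : (0 : E5 n) ∈ interior K) (hn : 0 < n) {q : ℝ} (hq : 0 < q) {u : E5 n} (hu : ‖u‖ = 1) :
    ∫⁻ r : Ioi (0 : ℝ), normRpowIndicator K (q - n) ((r : ℝ) • u)
      ∂(Measure.volumeIoiPow (n - 1)) = ENNReal.ofReal (radialFunction K u ^ q / q) := by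
  obtain ⟨hpos, hIoc⟩ := setOf_pos_smul_mem_eq_Ioc hKc hKconv h0 hu
  have hm : Measurable fun r : ℝ => normRpowIndicator K (q - n) (r • u) :=
    (measurable_normRpowIndicator hKc.measurableSet).comp (by fun_prop)
  rw [Measure.volumeIoiPow, lintegral_withDensity_eq_lintegral_mul _ (by fun_prop)
    (g := fun r : Ioi (0 : ℝ) => normRpowIndicator K (q - n) ((r : ℝ) • u))
    (hm.comp measurable_subtype_coe)]
  simp only [Pi.mul_apply]
  rw [lintegral_subtype_comap measurableSet_Ioi
    (fun r : ℝ => ENNReal.ofReal (r ^ (n - 1)) * normRpowIndicator K (q - n) (r • u))]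
  have e : ∀ r ∈ Ioi (0 : ℝ),
      ENNReal.ofReal (r ^ (n - 1)) * normRpowIndicator K (q - n) (r • u) =
      (Ioc 0 (radialFunction K u)).indicator (fun r => ENNReal.ofReal (r ^ (q - 1))) r := by
    intro r hr
    rw [← hIoc]
    have hr0 : 0 < r := hr
    by_cases hrK : r • u ∈ K
    · have : r ∈ {r : ℝ | 0 < r ∧ r • u ∈ K} := ⟨hr0, hrK⟩
      simp only [normRpowIndicator, hrK, this, indicator_of_mem]
      rw [norm_smul, hu, mul_one, Real.norm_of_nonneg hr0.le, ← ENNReal.ofReal_mul (by positivity),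
        ← Real.rpow_natCast, ← Real.rpow_add hr0, Nat.cast_pred hn]
      congr 2
      ring
    · have : r ∉ {r : ℝ | 0 < r ∧ r • u ∈ K} := fun h => hrK h.2
      simp [normRpowIndicator, hrK]
  rw [setLIntegral_congr_fun measurableSet_Ioi e, setLIntegral_indicator measurableSet_Ioc,
    inter_eq_left.2 Ioc_subset_Ioi_self]
  have hint : IntervalIntegrable (fun r : ℝ => r ^ (q - 1)) volume 0 (radialFunction K u) :=
    intervalIntegral.intervalIntegrable_rpow' (by linarith)
  rw [← ofReal_integral_eq_lintegral_ofReal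
    ((intervalIntegrable_iff_integrableOn_Ioc_of_le hpos.le).1 hint)
    ((ae_restrict_mem measurableSet_Ioc).mono fun r hr => Real.rpow_nonneg hr.1.le _),
    ← intervalIntegral.integral_of_le hpos.le, integral_rpow (Or.inl (by linarith))]
  congr 1
  simp [hq.ne']

/-- Measurability of the radial integrand is obtained along the way, since it is a partial integral
of a jointly measurable function. -/
theorem lintegral_normRpowIndicator_eq_sphere (hKc : IsCompact K) (hKconv : Convex ℝ K)
    (h0 : (0 : E5 n) ∈ interior K) (hn : 0 < n) {q : ℝ} (hq : 0 < q) :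
    Measurable (fun u : unitSphere n => ENNReal.ofReal (radialFunction K (u : E5 n) ^ q / q)) ∧
    ∫⁻ z, normRpowIndicator K (q - n) z =
      ∫⁻ u : unitSphere n, ENNReal.ofReal (radialFunction K (u : E5 n) ^ q / q)
        ∂(sphereMeasure n) := by
  have hm := measurable_normRpowIndicator (p := q - n) hKc.measurableSet
  have hu : ∀ u : unitSphere n, ‖(u : E5 n)‖ = 1 := fun u => by simp
  have hm2 : Measurable fun z : unitSphere n × Ioi (0 : ℝ) =>
      normRpowIndicator K (q - n) ((z.2 : ℝ) • (z.1 : E5 n)) := hm.comp (by fun_prop)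
  have e := fun u : unitSphere n =>
    lintegral_volumeIoiPow_normRpowIndicator hKc hKconv h0 hn hq (hu u)
  constructor
  · simp_rw [← e]
    exact hm2.lintegral_prod_right'
  · simp_rw [← e]
    have : Nontrivial (E5 n) := Module.nontrivial_of_finrank_pos (R := ℝ) (by simpa using hn)
    rw [sphereMeasure, ← lintegral_prod _ hm2.aemeasurable]
    have hmp := (volume : Measure (E5 n)).measurePreserving_homeomorphUnitSphereProd
    rw [finrank_euclideanSpace_fin] at hmp
    have e2 : ∀ a : ({0}ᶜ : Set (E5 n)), ((homeomorphUnitSphereProd (E5 n) a).2 : ℝ) •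
        ((homeomorphUnitSphereProd (E5 n) a).1 : E5 n) = a := by
      intro a
      rw [← homeomorphUnitSphereProd_symm_apply_coe, Homeomorph.symm_apply_apply]
    rw [← hmp.lintegral_comp hm2]
    simp_rw [e2]
    rw [lintegral_subtype_comap (measurableSet_singleton (0 : E5 n)).compl
      (normRpowIndicator K (q - n)), restrict_compl_singleton]

end

theorem sectionFunction_eq_toReal {n : ℕ} {K : Set (E5 n)} (hK : MeasurableSet K)
    (L : Submodule ℝ (E5 n)) (q : ℝ) (x : L) :
    sectionFunction K L q x = (sectionMass K L (q - n) (x : E5 n)).toReal := by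
  set f : Lᗮ → E5 n := fun y => (x : E5 n) + y with hf
  have hiso : Isometry f := Isometry.of_dist_eq fun a b => by simp [hf, Subtype.dist_eq]
  have hfm : Measurable f := by fun_prop
  have hm : Measurable fun z : E5 n => ‖z‖ ^ (q - (n : ℝ)) := by fun_prop
  have hrange : ({(x : E5 n)} + (Lᗮ : Set (E5 n))) = range f := by
    ext z
    simp only [hf, singleton_add, image_add_left, mem_preimage, SetLike.mem_coe, mem_range]
    exact ⟨fun h => ⟨⟨_, h⟩, by simp⟩, by rintro ⟨y, rfl⟩; simp⟩
  have hmap := hiso.map_euclideanHausdorffMeasure (d := finrank ℝ Lᗮ)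
  rw [InnerProductSpace.euclideanHausdorffMeasure_eq_volume] at hmap
  rw [sectionFunction, hrange, ← Measure.restrict_restrict hK, ← hmap,
    setIntegral_map hK hm.aestronglyMeasurable hfm.aemeasurable,
    integral_eq_lintegral_of_nonneg_ae (Filter.Eventually.of_forall fun y => by positivity)
      (Measurable.aestronglyMeasurable (by fun_prop)), sectionMass_eq_setLIntegral hK]
  rfl

/-! ### Radial derivatives and their integrability. -/

section

variable {V : Type*} [NormedAddCommGroup V] [NormedSpace ℝ V]

/-- A lower bound for a function along a segment towards the origin bounds its radial
derivative. -/
theorem mul_fderiv_self_le_of_forall_mul_le {g : V → ℝ} {x : V} (hg : DifferentiableAt ℝ g x)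
    {b : ℝ → ℝ} {b' c : ℝ} (hb : HasDerivAt b b' 0) (hb0 : b 0 = 1)
    (h : ∀ᶠ t in nhdsWithin (0 : ℝ) (Ioi 0), b t * g x ≤ g ((1 - t * c) • x)) :
    c * fderiv ℝ g x x ≤ -b' * g x := by
  have hline : HasDerivAt (fun t : ℝ => (1 - t * c) • x) (-c • x) 0 := by
    have : HasDerivAt (fun t : ℝ => 1 - t * c) (-c) 0 := by
      simpa using ((hasDerivAt_id (0 : ℝ)).mul_const c).const_sub 1
    exact this.smul_const x
  have hg' : HasFDerivAt g (fderiv ℝ g x) ((1 - (0 : ℝ) * c) • x) := by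
    simpa using hg.hasFDerivAt
  -- The difference of the two sides of `h` vanishes at `t = 0` and is nonnegative for small `t >
  -- 0`, so its derivative at `0` is nonnegative.
  have hcomp := (hg'.comp_hasDerivAt (0 : ℝ) hline).sub (hb.mul_const (g x))
  have hlim := (hasDerivAt_iff_tendsto_slope.1 hcomp).mono_left (nhdsGT_le_nhdsNE 0)
  have hnn := ge_of_tendsto (b := 0) hlim (by
    filter_upwards [h, self_mem_nhdsWithin] with t ht ht0
    have ht0' : (0 : ℝ) < t := ht0
    simp only [slope, Function.comp, Pi.sub_apply, zero_mul, sub_zero, one_smul, hb0, one_mul,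
      sub_self, vsub_eq_sub, smul_eq_mul]
    exact mul_nonneg (by positivity) (by linarith))
  simp only [map_smul, smul_eq_mul] at hnn
  linarith

theorem hasDerivAt_one_sub_mul_rpow (c a : ℝ) :
    HasDerivAt (fun t : ℝ => (1 - t * c) ^ a) (-(c * a)) 0 := by
  have : HasDerivAt (fun t : ℝ => 1 - t * c) (-c) 0 := by
    simpa using ((hasDerivAt_id (0 : ℝ)).mul_const c).const_sub 1
  simpa using this.rpow_const (p := a) (Or.inl (by simp))

variable [FiniteDimensional ℝ V] [MeasurableSpace V] [BorelSpace V]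

open Filter Topology in
/-- A nonnegative integrable function that is bounded below along rays by a power has an
integrable radial derivative. -/
theorem integrableOn_fderiv_self_of_rpow_mul_le {μ : Measure V} [μ.IsAddHaarMeasure]
    [Nontrivial V] {g : V → ℝ} (hgi : Integrable g μ) {C : ℝ}
    (hray : ∀ x ≠ 0, ∀ r, 0 < r → r ≤ 1 → r ^ C * g x ≤ g (r • x)) {P : Set V}
    (hdiff : ∀ᵐ x ∂μ.restrict P, DifferentiableAt ℝ g x) :
    IntegrableOn (fun x => fderiv ℝ g x x) P μ := by
  set d := finrank ℝ V
  have hne : ∀ᵐ x ∂μ, x ≠ 0 := by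
    rw [ae_iff]; simp
  set t : ℕ → ℝ := fun k => 1 / ((k : ℝ) + 2) with ht
  have ht0 : ∀ k, 0 < t k := fun k => by positivity
  have ht1 : ∀ k, t k < 1 := fun k => by
    rw [ht]; simp only; rw [div_lt_one (by positivity)]; linarith [(k.cast_nonneg : (0:ℝ) ≤ k)]
  have htlim : Tendsto t atTop (𝓝[>] 0) := by
    refine tendsto_nhdsWithin_iff.2 ⟨?_, Eventually.of_forall ht0⟩
    have := (tendsto_one_div_add_atTop_nhds_zero_nat (𝕜 := ℝ)).comp (tendsto_add_atTop_nat 1)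
    refine this.congr fun k => ?_
    simp only [ht, Function.comp]; push_cast; ring
  -- These quotients are nonnegative off the origin by `hray`, tend to `C * g x - fderiv ℝ g x x`
  -- where `g` is differentiable, and have integrals computed by scaling. Fatou's lemma then makes
  -- the limit integrable on `P`.
  set D : ℕ → V → ℝ := fun k x => (g ((1 - t k) • x) - (1 - t k) ^ C * g x) / t k with hD
  have hDnn : ∀ k, ∀ᵐ x ∂μ, 0 ≤ D k x := by
    intro k
    filter_upwards [hne] with x hx
    exact div_nonneg (sub_nonneg.2 (hray x hx _ (by linarith [ht1 k]) (by linarith [ht0 k])))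
      (ht0 k).le
  have hDi : ∀ k, Integrable (D k) μ := fun k =>
    ((hgi.comp_smul (by linarith [ht1 k] : (1 - t k) ≠ 0)).sub (hgi.const_mul _)).div_const _
  have hDint : ∀ k, ∫ x, D k x ∂μ =
      (((1 - t k * 1) ^ (-(d : ℝ)) - (1 - t k * 1) ^ C) / t k) * ∫ x, g x ∂μ := by
    intro k
    have h1 : 0 < 1 - t k := by linarith [ht1 k]
    have := integral_sub (hgi.comp_smul h1.ne') (hgi.const_mul ((1 - t k) ^ C))
    simp only [hD]
    rw [integral_div, this, Measure.integral_comp_smul_of_nonneg _ _ _ (hR := h1.le),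
      integral_const_mul, mul_one, Real.rpow_neg h1.le, Real.rpow_natCast, smul_eq_mul]
    ring
  have hDlim : Tendsto (fun k => ∫ x, D k x ∂μ) atTop (𝓝 ((d + C) * ∫ x, g x ∂μ)) := by
    simp_rw [hDint]
    refine Tendsto.mul_const _ ?_
    have hder := (hasDerivAt_one_sub_mul_rpow 1 (-(d : ℝ))).sub (hasDerivAt_one_sub_mul_rpow 1 C)
    have hs := ((hasDerivAt_iff_tendsto_slope.1 hder).mono_left (nhdsGT_le_nhdsNE 0)).comp htlim
    convert hs using 1
    · funext k
      simp [slope, div_eq_inv_mul]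
    · congr 1; ring
  have hlimpt : ∀ x, DifferentiableAt ℝ g x →
      Tendsto (fun k => D k x) atTop (𝓝 (C * g x - fderiv ℝ g x x)) := by
    intro x hx
    have hline : HasDerivAt (fun t : ℝ => (1 - t * 1) • x) (-(1 : ℝ) • x) 0 := by
      have : HasDerivAt (fun t : ℝ => 1 - t * 1) (-1) 0 := by
        simpa using ((hasDerivAt_id (0 : ℝ)).mul_const 1).const_sub 1
      exact this.smul_const x
    have hg' : HasFDerivAt g (fderiv ℝ g x) ((1 - (0 : ℝ) * 1) • x) := by
      simpa using hx.hasFDerivAt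
    have hcomp := (hg'.comp_hasDerivAt (0 : ℝ) hline).sub
      ((hasDerivAt_one_sub_mul_rpow 1 C).mul_const (g x))
    have hs := ((hasDerivAt_iff_tendsto_slope.1 hcomp).mono_left (nhdsGT_le_nhdsNE 0)).comp htlim
    convert hs using 1
    · funext k
      simp [hD, slope, div_eq_inv_mul]
    · congr 1
      simp
      ring
  have hmeas : Measurable fun x => fderiv ℝ g x x := by
    have : Measurable fun x : V => (fderiv ℝ g x, x) := (measurable_fderiv ℝ g).prodMk measurable_id
    exact (isBoundedBilinearMap_apply (𝕜 := ℝ) (E := V) (F := ℝ)).continuous.measurable.comp this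
  have hDae : ∀ᵐ x ∂μ.restrict P, 0 ≤ C * g x - fderiv ℝ g x x := by
    have hall : ∀ᵐ x ∂μ.restrict P, ∀ k, 0 ≤ D k x :=
      ae_all_iff.2 fun k => ae_restrict_of_ae (hDnn k)
    filter_upwards [hdiff, hall] with x hx hx2
    exact ge_of_tendsto' (hlimpt x hx) hx2
  have hfin : ∫⁻ x in P, ENNReal.ofReal (C * g x - fderiv ℝ g x x) ∂μ < ⊤ := by
    calc ∫⁻ x in P, ENNReal.ofReal (C * g x - fderiv ℝ g x x) ∂μ
        = ∫⁻ x in P, liminf (fun k => ENNReal.ofReal (D k x)) atTop ∂μ := by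
          refine lintegral_congr_ae ?_
          filter_upwards [hdiff] with x hx
          exact ((ENNReal.continuous_ofReal.tendsto _).comp (hlimpt x hx)).liminf_eq.symm
      _ ≤ liminf (fun k => ∫⁻ x in P, ENNReal.ofReal (D k x) ∂μ) atTop :=
          lintegral_liminf_le' fun k => (hDi k).aemeasurable.ennreal_ofReal.restrict
      _ ≤ liminf (fun k => ENNReal.ofReal (∫ x, D k x ∂μ)) atTop := by
          refine liminf_le_liminf (Eventually.of_forall fun k => ?_)
          rw [ofReal_integral_eq_lintegral_ofReal (hDi k) (hDnn k)]
          exact setLIntegral_le_lintegral _ _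
      _ = ENNReal.ofReal ((d + C) * ∫ x, g x ∂μ) :=
          ((ENNReal.continuous_ofReal.tendsto _).comp hDlim).liminf_eq
      _ < ⊤ := ENNReal.ofReal_lt_top
  have hDI : Integrable (fun x => C * g x - fderiv ℝ g x x) (μ.restrict P) := by
    refine ⟨((hgi.const_mul C).aestronglyMeasurable.restrict).sub hmeas.aestronglyMeasurable, ?_⟩
    rw [hasFiniteIntegral_iff_ofReal hDae]
    exact hfin
  refine (((hgi.const_mul C).restrict (s := P)).sub hDI).congr (Eventually.of_forall fun x => ?_)
  simp

end

/-! ### Derivative bounds and the final estimate. -/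

section

variable {n : ℕ} {K : Set (E5 n)}

theorem integrable_sectionFunction (hKc : IsCompact K) (hKconv : Convex ℝ K)
    (h0 : (0 : E5 n) ∈ interior K) (hn : 0 < n) {q : ℝ} (hq : 0 < q)
    (L : Submodule ℝ (E5 n)) :
    Integrable (sectionFunction K L q) volume ∧
      ∫ x, sectionFunction K L q x = n * dualCurvatureMeasure K q univ / q := by
  obtain ⟨hm, hpolar⟩ := lintegral_normRpowIndicator_eq_sphere hKc hKconv h0 hn hq
  have hu : ∀ u : unitSphere n, ‖(u : E5 n)‖ = 1 := fun u => by simp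
  have hρ : ∀ u : unitSphere n, 0 < radialFunction K (u : E5 n) := fun u =>
    (setOf_pos_smul_mem_eq_Ioc hKc hKconv h0 (hu u)).1
  have : IsFiniteMeasure (sphereMeasure n) := by unfold sphereMeasure; infer_instance
  obtain ⟨R, hR⟩ := hKc.isBounded.exists_norm_le
  have hρR : ∀ u : unitSphere n, radialFunction K (u : E5 n) ≤ R := by
    intro u
    obtain ⟨hpos, hIoc⟩ := setOf_pos_smul_mem_eq_Ioc hKc hKconv h0 (hu u)
    have : radialFunction K (u : E5 n) ∈ {r : ℝ | 0 < r ∧ r • (u : E5 n) ∈ K} := by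
      rw [hIoc]; exact ⟨hpos, le_rfl⟩
    have := hR _ this.2
    rwa [norm_smul, hu, mul_one, Real.norm_of_nonneg hpos.le] at this
  have hGfin : ∫⁻ x : L, sectionMass K L (q - n) (x : E5 n) ≠ ⊤ := by
    rw [lintegral_sectionMass hKc.measurableSet, hpolar]
    refine ne_top_of_le_ne_top ?_ (lintegral_mono (g := fun _ => ENNReal.ofReal (R ^ q / q))
      fun u => ENNReal.ofReal_le_ofReal ?_)
    · rw [lintegral_const]
      exact ENNReal.mul_ne_top ENNReal.ofReal_ne_top (measure_ne_top _ _)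
    · exact div_le_div_of_nonneg_right (Real.rpow_le_rpow (hρ u).le (hρR u) hq.le) hq.le
  have hGm : Measurable fun x : L => sectionMass K L (q - n) (x : E5 n) := by
    have : Measurable fun z : L × Lᗮ => normRpowIndicator K (q - n) ((z.1 : E5 n) + z.2) :=
      (measurable_normRpowIndicator hKc.measurableSet).comp (by fun_prop)
    exact this.lintegral_prod_right'
  have hfun : sectionFunction K L q = fun x : L => (sectionMass K L (q - n) (x : E5 n)).toReal :=
    funext fun x => sectionFunction_eq_toReal hKc.measurableSet L q x
  have hint : n * dualCurvatureMeasure K q univ / q =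
      ∫ u : unitSphere n, radialFunction K (u : E5 n) ^ q / q ∂(sphereMeasure n) := by
    have : (n : ℝ) ≠ 0 := by positivity
    rw [dualCurvatureMeasure, reverseRadialGaussImage_univ hKc hKconv h0, Measure.restrict_univ,
      integral_div, ← mul_assoc, mul_one_div_cancel this, one_mul]
  rw [hfun]
  refine ⟨integrable_toReal_of_lintegral_ne_top hGm.aemeasurable hGfin, ?_⟩
  have hm' : Measurable fun u : unitSphere n => radialFunction K (u : E5 n) ^ q / q := by
    convert hm.ennreal_toReal using 2 with u
    exact (ENNReal.toReal_ofReal (div_nonneg (Real.rpow_nonneg (hρ u).le _) hq.le)).symm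
  rw [integral_toReal hGm.aemeasurable (ae_lt_top hGm hGfin), hint,
    lintegral_sectionMass hKc.measurableSet, hpolar,
    integral_eq_lintegral_of_nonneg_ae (Filter.Eventually.of_forall fun u =>
      div_nonneg (Real.rpow_nonneg (hρ u).le _) hq.le) hm'.aestronglyMeasurable]

theorem toReal_mul_sectionFunction_le (hKc : IsCompact K) {L : Submodule ℝ (E5 n)} {q c : ℝ}
    (hc : 0 ≤ c) {x : L} {y : L} (hy : y ≠ 0)
    (h : ENNReal.ofReal c * sectionMass K L (q - n) (x : E5 n) ≤
      sectionMass K L (q - n) (y : E5 n)) :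
    c * sectionFunction K L q x ≤ sectionFunction K L q y := by
  have hy' : (y : E5 n) ≠ 0 := by simpa using hy
  have := ENNReal.toReal_mono
    (sectionMass_lt_top (p := q - n) hKc.measurableSet hKc.isBounded y.2 hy').ne h
  rwa [ENNReal.toReal_mul, ENNReal.toReal_ofReal hc,
    ← sectionFunction_eq_toReal hKc.measurableSet, ← sectionFunction_eq_toReal hKc.measurableSet]
    at this

theorem eventually_contraction_pos {γ : ℝ} :
    ∀ᶠ t in nhdsWithin (0 : ℝ) (Ioi 0), 0 ≤ t ∧ 0 < 1 - t * (1 + γ) := by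
  have hc : Continuous fun t : ℝ => 1 - t * (1 + γ) := by fun_prop
  have : ∀ᶠ t in nhds (0 : ℝ), 0 < 1 - t * (1 + γ) :=
    (hc.tendsto 0).eventually (lt_mem_nhds (by simp))
  filter_upwards [nhdsWithin_le_nhds this, self_mem_nhdsWithin] with t h1 h2
    using ⟨(show (0 : ℝ) < t from h2).le, h1⟩

/-- The contraction moves at speed `1 + γ`, while `s ^ (q - dim L)` decreases at rate `(1 - γ)(q -
dim L)`; the bound is the quotient of the two. -/
theorem fderiv_sectionFunction_self_le_of_le (hKc : IsCompact K) (hKconv : Convex ℝ K)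
    {γ : ℝ} (hγ : 0 ≤ γ) (hγK : γ • (-K) ⊆ K) {L : Submodule ℝ (E5 n)} {q : ℝ}
    (hq : q ≤ n) {x : L} (hx : x ≠ 0) (hd : DifferentiableAt ℝ (sectionFunction K L q) x) :
    fderiv ℝ (sectionFunction K L q) x x ≤
      ((q - n + finrank ℝ Lᗮ) * ((1 - γ) / (1 + γ))) * sectionFunction K L q x := by
  have key := mul_fderiv_self_le_of_forall_mul_le (c := 1 + γ) hd
    (hasDerivAt_one_sub_mul_rpow (1 - γ) (q - n + finrank ℝ Lᗮ)) (by simp) (by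
      filter_upwards [eventually_contraction_pos (γ := γ)] with t ht
      have hs : 0 < 1 - t * (1 - γ) := by nlinarith [mul_nonneg ht.1 hγ]
      exact toReal_mul_sectionFunction_le hKc (Real.rpow_nonneg hs.le _)
        (smul_ne_zero ht.2.ne' hx) (ofReal_mul_sectionMass_le_of_nonpos hKc.measurableSet
          hKc.isBounded hKconv hγ hγK (sub_nonpos.2 hq) x.2 (by simpa using hx) ht.1 ht.2))
  have h1 : 0 < 1 + γ := by linarith
  rw [mul_div_assoc', div_mul_eq_mul_div, le_div_iff₀ h1]
  linarith

/-- Here the factor is `s ^ dim Lᗮ * l ^ (q - n)`. Its second part decreases at rate `(1 + γ)(q -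
n)`, so dividing by the speed `1 + γ` leaves `q - n` without any gain from `γ`. -/
theorem fderiv_sectionFunction_self_le_of_add_one_le (hKc : IsCompact K) (hKconv : Convex ℝ K)
    {γ : ℝ} (hγ : 0 ≤ γ) (hγK : γ • (-K) ⊆ K) {L : Submodule ℝ (E5 n)} {q : ℝ}
    (hq : n + 1 ≤ q) {x : L} (hx : x ≠ 0)
    (hd : DifferentiableAt ℝ (sectionFunction K L q) x) :
    fderiv ℝ (sectionFunction K L q) x x ≤
      (q - n + (1 - γ) / (1 + γ) * finrank ℝ Lᗮ) * sectionFunction K L q x := by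
  have hb := (hasDerivAt_one_sub_mul_rpow (1 - γ) (finrank ℝ Lᗮ)).mul
    (hasDerivAt_one_sub_mul_rpow (1 + γ) (q - n))
  have key := mul_fderiv_self_le_of_forall_mul_le (c := 1 + γ) hd hb (by simp) (by
      filter_upwards [eventually_contraction_pos (γ := γ)] with t ht
      have hs : 0 < 1 - t * (1 - γ) := by nlinarith [mul_nonneg ht.1 hγ]
      refine toReal_mul_sectionFunction_le hKc
        (mul_nonneg (Real.rpow_nonneg hs.le _) (Real.rpow_nonneg ht.2.le _))
        (smul_ne_zero ht.2.ne' hx) ?_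
      rw [Real.rpow_natCast]
      exact ofReal_mul_sectionMass_le_of_one_le hKc.measurableSet
          hKc.isBounded hKconv hγ hγK (by linarith) x ht.1 ht.2)
  have h1 : 0 < 1 + γ := by linarith
  have e : (q - n + (1 - γ) / (1 + γ) * finrank ℝ Lᗮ) * sectionFunction K L q x =
    ((q - n) * (1 + γ) + (1 - γ) * finrank ℝ Lᗮ) * sectionFunction K L q x / (1 + γ) := by
    field_simp
  rw [e, le_div_iff₀ h1]
  simp only [zero_mul, sub_zero, Real.one_rpow, mul_one, one_mul] at key
  linarith

theorem one_div_mul_setIntegral_le_of_le {V : Type*} [MeasurableSpace V] {μ : Measure V}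
    {P : Set V} {f g : V → ℝ} {T q c : ℝ} (hq : 0 < q) (hc : 0 ≤ c) (hg0 : ∀ x, 0 ≤ g x)
    (hgi : Integrable g μ) (hg : ∫ x, g x ∂μ = T / q) (hf : IntegrableOn f P μ)
    (hfg : ∀ᵐ x ∂μ.restrict P, f x ≤ c * g x) :
    1 / T * ∫ x in P, f x ∂μ ≤ c / q := by
  have h1 : ∫ x in P, f x ∂μ ≤ c * (T / q) := by
    rw [← hg]
    calc ∫ x in P, f x ∂μ ≤ ∫ x in P, c * g x ∂μ :=
          integral_mono_ae hf (hgi.const_mul c).integrableOn hfg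
      _ = c * ∫ x in P, g x ∂μ := integral_const_mul _ _
      _ ≤ c * ∫ x, g x ∂μ := mul_le_mul_of_nonneg_left
          (setIntegral_le_integral hgi (Filter.Eventually.of_forall hg0)) hc
  have hT : 0 ≤ T := by
    have := hg ▸ integral_nonneg (μ := μ) hg0
    rwa [le_div_iff₀ hq, zero_mul] at this
  rcases hT.eq_or_lt with h | h
  -- For `T = 0` the convention `1 / 0 = 0` makes the left side vanish.
  · rw [← h]; simp; positivity
  · rw [one_div, inv_mul_le_iff₀ h]
    exact h1.trans_eq (by ring)

end

theorem mainTheorem5 (n : ℕ) (K : ConvexBody (EuclideanSpace ℝ (Fin n)))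
    (hK : (0 : EuclideanSpace ℝ (Fin n)) ∈ interior (K : Set (EuclideanSpace ℝ (Fin n))))
    (γ : ℝ) (hγ₀ : 0 < γ) (hγ₁ : γ ≤ 1)
    (hγK : γ • (-(K : Set (EuclideanSpace ℝ (Fin n)))) ⊆ (K : Set (EuclideanSpace ℝ (Fin n))))
    (L : Submodule ℝ (EuclideanSpace ℝ (Fin n))) (hL : L ≠ ⊤)
    (q : ℝ) (hq : (finrank ℝ L : ℝ) + 1 < q) :
    (∀ᵐ x ∂((μHE[finrank ℝ L] : Measure L).restrict (projectionOnto K L)),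
      DifferentiableAt ℝ (sectionFunction (K : Set (EuclideanSpace ℝ (Fin n))) L q) x) ∧
    IntegrableOn
      (fun x : L => inner ℝ (∇ (sectionFunction (K : Set (EuclideanSpace ℝ (Fin n))) L q) x) x)
      (projectionOnto K L) μHE[finrank ℝ L] ∧
    (q ≤ (n : ℝ) →
      1 / ((n : ℝ) * dualCurvatureMeasure (K : Set (EuclideanSpace ℝ (Fin n))) q univ) *
        ∫ x in projectionOnto K L,
          inner ℝ (∇ (sectionFunction (K : Set (EuclideanSpace ℝ (Fin n))) L q) x) x
            ∂μHE[finrank ℝ L]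
      ≤ (q - (finrank ℝ L : ℝ)) / q * ((1 - γ) / (1 + γ))) ∧
    ((n : ℝ) + 1 < q →
      1 / ((n : ℝ) * dualCurvatureMeasure (K : Set (EuclideanSpace ℝ (Fin n))) q univ) *
        ∫ x in projectionOnto K L,
          inner ℝ (∇ (sectionFunction (K : Set (EuclideanSpace ℝ (Fin n))) L q) x) x
            ∂μHE[finrank ℝ L]
      ≤ ((q - (n : ℝ)) + (1 - γ) / (1 + γ) * ((n : ℝ) - (finrank ℝ L : ℝ))) / q) := by
  have hlt : finrank ℝ L < n := by
    simpa using Submodule.finrank_lt hL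
  have hn : 0 < n := by omega
  have hLn : (finrank ℝ L : ℝ) < n := by exact_mod_cast hlt
  have hd0 : (0 : ℝ) ≤ finrank ℝ L := Nat.cast_nonneg _
  have hq0 : 0 < q := by linarith
  have hdim : (finrank ℝ Lᗮ : ℝ) = n - finrank ℝ L := by
    have := L.finrank_add_finrank_orthogonal
    rw [finrank_euclideanSpace_fin] at this
    rw [eq_sub_iff_add_eq']
    exact_mod_cast this
  have hβ : 0 ≤ (1 - γ) / (1 + γ) := div_nonneg (by linarith) (by linarith)
  rw [InnerProductSpace.euclideanHausdorffMeasure_eq_volume]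
  have hinner : ∀ x : L, inner ℝ (∇ (sectionFunction (K : Set (E5 n)) L q) x) x =
      fderiv ℝ (sectionFunction (K : Set (E5 n)) L q) x x := fun x =>
    InnerProductSpace.toDual_symm_apply
  simp_rw [hinner]
  -- For `L = {0}` the origin is not a null set, but radial derivatives vanish and both right-hand
  -- sides are nonnegative.
  rcases subsingleton_or_nontrivial L with hsub | hnt
  · have hz : ∀ x : L, fderiv ℝ (sectionFunction (K : Set (E5 n)) L q) x x = 0 := fun x => by
      rw [Subsingleton.elim x 0, map_zero]
    simp_rw [hz]
    refine ⟨Filter.Eventually.of_forall fun x => ?_, integrableOn_zero, fun _ => ?_, fun h => ?_⟩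
    · exact (hasFDerivAt_of_subsingleton _ x).differentiableAt
    · rw [integral_zero, mul_zero]
      exact mul_nonneg (div_nonneg (by linarith) hq0.le) hβ
    · rw [integral_zero, mul_zero]
      exact div_nonneg (add_nonneg (by linarith) (mul_nonneg hβ (by linarith))) hq0.le
  have hKm := K.isCompact.measurableSet
  have hfun : sectionFunction (K : Set (E5 n)) L q =
      fun x : L => (sectionMass (K : Set (E5 n)) L (q - n) (x : E5 n)).toReal :=
    funext fun x => sectionFunction_eq_toReal hKm L q x
  have hdiff : ∀ᵐ x ∂((volume : Measure L).restrict (projectionOnto K L)),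
      DifferentiableAt ℝ (sectionFunction (K : Set (E5 n)) L q) x := by
    rw [hfun]
    exact ae_differentiableAt_sectionMass hKm K.isCompact.isBounded K.convex
  obtain ⟨hgi, hg⟩ := integrable_sectionFunction K.isCompact K.convex hK hn hq0 L
  have hg0 : ∀ x, 0 ≤ sectionFunction (K : Set (E5 n)) L q x := fun x => by
    rw [hfun]; exact ENNReal.toReal_nonneg
  have hfi : IntegrableOn (fun x => fderiv ℝ (sectionFunction (K : Set (E5 n)) L q) x x)
      (projectionOnto K L) volume := by
    refine integrableOn_fderiv_self_of_rpow_mul_le hgi (C := q - n + finrank ℝ Lᗮ)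
      (fun x hx r hr0 hr1 => ?_) hdiff
    exact toReal_mul_sectionFunction_le K.isCompact (Real.rpow_nonneg hr0.le _)
      (smul_ne_zero hr0.ne' hx)
      (ofReal_rpow_mul_sectionMass_le hKm K.convex (interior_subset hK) x hr0 hr1)
  have hne : ∀ᵐ x ∂((volume : Measure L).restrict (projectionOnto K L)), x ≠ 0 :=
    ae_restrict_of_ae (by rw [ae_iff]; simp)
  refine ⟨hdiff, hfi, fun hqn => ?_, fun hqn => ?_⟩
  · have hc : 0 ≤ (q - n + finrank ℝ Lᗮ) * ((1 - γ) / (1 + γ)) :=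
      mul_nonneg (by rw [hdim]; linarith) hβ
    have := one_div_mul_setIntegral_le_of_le hq0 hc hg0 hgi hg hfi (by
      filter_upwards [hdiff, hne] with x hx hx0
      exact fderiv_sectionFunction_self_le_of_le K.isCompact K.convex hγ₀.le hγK hqn hx0 hx)
    refine this.trans_eq ?_
    rw [hdim]; ring
  · have hc : 0 ≤ q - n + (1 - γ) / (1 + γ) * finrank ℝ Lᗮ :=
      add_nonneg (by linarith) (mul_nonneg hβ (Nat.cast_nonneg _))
    have := one_div_mul_setIntegral_le_of_le hq0 hc hg0 hgi hg hfi (by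
      filter_upwards [hdiff, hne] with x hx hx0
      exact fderiv_sectionFunction_self_le_of_add_one_le K.isCompact K.convex hγ₀.le hγK
        hqn.le hx0 hx)
    rwa [hdim] at this
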